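/- Let $\hbar>0$, $s>0$, $\vartheta\in\mathbb R\setminus\{0\}$, $\kappa,\delta\in\mathbb R$ (the degenerate case, $\mathcal B=\hbar^2/\vartheta$), and let $\mu$ be an arbitrary Borel probability measure on $\mathbb R^2$. On $\mathbb R^4$ with coordinates $(\mathbf q,\mathbf p)=(q_1,q_2,p_1,p_2)$ put $d\tilde\nu=\frac1{2\pi\hbar}\,dq_1\,dp_1\,d\mu(q_2,p_2)$ and $$q_1^{NC}=q_1-\tfrac{\vartheta}{\hbar}p_2,\qquad p_1^{NC}=p_1+\tfrac{\hbar}{\vartheta}q_2+2\kappa\hbar,\qquad z^{NC}=\sqrt{\tfrac\hbar2}\,\frac{q_1^{NC}}s-\frac{is\,p_1^{NC}}{\sqrt{2\hbar}} .$$ With $\tilde\eta(r)=\pi^{-1/4}s^{-1/2}e^{-r^2/2s^2}$, the degenerate coherent states are $$\tilde\eta_{\mathbf q,\mathbf p}(r)=e^{-i\kappa q_1-i\delta q_2-\frac{ir}{\hbar}(p_1+\frac\hbar\vartheta q_2)-\frac i{2\hbar}(q_1p_1-q_2p_2)+\frac i2(-\frac{q_1q_2}\vartheta+\frac\vartheta{\hbar^2}p_1p_2)}\,\tilde\eta\big(r+q_1-\tfrac\vartheta\hbar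 p_2\big),$$ and $\tilde K^{NC}((\mathbf q,\mathbf p),(\mathbf q',\mathbf p'))=\int_{\mathbb R}\overline{\tilde\eta_{\mathbf q,\mathbf p}(r)}\,\tilde\eta_{\mathbf q',\mathbf p'}(r)\,dr$. Let $\widetilde{\mathcal W}$ be the closed subspace of $L^2(\mathbb R^4,d\tilde\nu)$ generated by the functions $\tilde K^{NC}(\cdot,(\mathbf q',\mathbf p'))$, let $\tilde F_\hbar(\mathbb C)$ be the Fock space of entire functions in $L^2(\mathbb C,(\pi\hbar)^{-1}e^{-|z|^2/\hbar}dA)$, and for bounded symbols let $T_fu=P(fu)$ and $\tilde{\mathcal T}_Fu=\mathcal P(Fu)$ be the Toeplitz operators on $\tilde F_\hbar(\mathbb C)$ and $\widetilde{\mathcal W}$, where $P$, $\mathcal P$ are the orthogonal projections of the respective $L^2$ spaces onto these subspaces. For $F\in L^\infty(\mathbb R^4,d\tilde\nu)$ put $$\varrho F(z)=\int_{\mathbb R^2}F\Big(Q+\tfrac\vartheta\hbar p_2,\;q_2,\;R-\tfrac\hbar\vartheta q_2-2\kappa\hbar,\;p_2\Big)d\mu(q_2,p_2),\qquad Q=\tfrac{s}{\sqrt{2\hbar}}(z+\bar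 z),\quad R=\tfrac{\sqrt{\hbar/2}}{is}(\bar z-z),$$ the arguments of $F$ being listed in the order $(q_1,q_2,p_1,p_2)$. (1) With the inner product of $L^2(\mathbb R^4,d\tilde\nu)$, $\widetilde{\mathcal W}$ is a reproducing kernel Hilbert space of functions on $\mathbb R^4$ with kernel $\tilde K^{NC}$, and $$\tilde Vf(\mathbf q,\mathbf p)=e^{i\delta q_2+i\kappa\vartheta p_2/\hbar}\,e^{-|z^{NC}|^2/2\hbar}f(z^{NC})$$ defines a unitary isomorphism $\tilde V$ of $\tilde F_\hbar(\mathbb C)$ onto $\widetilde{\mathcal W}$. (2) For all $F\in L^\infty(\mathbb R^4,d\tilde\nu)$ one has $\varrho F\in L^\infty(\mathbb C)$ and $\tilde V^*\tilde{\mathcal T}_F\tilde V=T_{\varrho F}$. (3) The map $\varrho^*f(\mathbf q,\mathbf p):=f(z^{NC})$ is a right inverse of $\varrho:L^\infty(\mathbb R^4,d\tilde\nu)\to L^\infty(\mathbb C)$, and $\varrho$ maps $C_c^\infty(\mathbb R^4)$ into $C_c^\infty(\mathbb C)$. (4) Let $S>0$ and let $s=S\sqrt\hbar$. For all complex-valued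 $F,G\in C_c^\infty(\mathbb R^4)$ there is, in the sense of operator norms, an asymptotic expansion $\tilde{\mathcal T}_F\tilde{\mathcal T}_G\approx\sum_{j\ge0}\hbar^j\,\tilde{\mathcal T}_{\tilde{\mathcal C}_j(F,G)}$ as $\hbar\searrow0$ with $$\tilde{\mathcal C}_j(F,G)=\varrho^*\tilde C_j(\varrho F,\varrho G),\qquad \tilde C_j(f,g)=\frac{(-1)^j}{j!}\frac{\partial^jf}{\partial z^j}\frac{\partial^jg}{\partial\bar z^j},$$ for any right inverse $\varrho^*$ of $\varrho$; precisely, for each $N\ge0$ there is a constant $C$, depending only on $S,F,G,N$, such that $$\Big\|\tilde{\mathcal T}_F\tilde{\mathcal T}_G-\sum_{j=0}^N\hbar^j\,\tilde{\mathcal T}_{\tilde{\mathcal C}_j(F,G)}\Big\|\le C\hbar^{N+1}$$ for all $\hbar>0$, $\vartheta\ne0$, $\kappa,\delta\in\mathbb R$, all probability measures $\mu$ and all right inverses $\varrho^*$. -/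

import Mathlib

open MeasureTheory

namespace DegenerateNC

/-! ### The one-dimensional Fock space -/

section FockSpace

open scoped ENNReal
open Complex

/-- Sub-mean-value inequality of an entire function over a disc. -/
theorem pi_mul_enorm_le_setLIntegral_ball {g : ℂ → ℂ} (hg : Differentiable ℂ g) (z : ℂ) :
    ENNReal.ofReal Real.pi * ‖g z‖ₑ ≤ ∫⁻ w in Metric.ball z 1, ‖g w‖ₑ := by
  have hcont : Continuous g := hg.continuous
  have key : ∀ r : ℝ, ENNReal.ofReal (2 * Real.pi) * ‖g z‖ₑ ≤
      ∫⁻ θ in Set.Ioo (-Real.pi) Real.pi, ‖g (z + r * (Real.cos θ + Real.sin θ * I))‖ₑ := by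
    intro r
    have h1 : Real.circleAverage g z r = g z := (hg.diffContOnCl).circleAverage
    have h2 : ∫ θ in (-Real.pi)..Real.pi, g (circleMap z r θ) = (2 * Real.pi : ℝ) • g z := by
      have hper : Function.Periodic (fun θ => g (circleMap z r θ)) (2 * Real.pi) := fun θ => by
        simp [periodic_circleMap z r θ]
      have := hper.intervalIntegral_add_eq (-Real.pi) 0
      rw [show -Real.pi + 2 * Real.pi = Real.pi by ring, zero_add] at this
      rw [this, ← h1, Real.circleAverage, smul_smul, mul_inv_cancel₀ (by positivity), one_smul]
    have h3 : ‖(2 * Real.pi : ℝ) • g z‖ₑ = ENNReal.ofReal (2 * Real.pi) * ‖g z‖ₑ := by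
      rw [enorm_smul, Real.enorm_eq_ofReal (by positivity)]
    rw [← h3, ← h2, intervalIntegral.integral_of_le (by linarith [Real.pi_pos]),
      integral_Ioc_eq_integral_Ioo]
    refine (enorm_integral_le_lintegral_enorm _).trans (le_of_eq ?_)
    refine lintegral_congr fun θ => ?_
    rw [circleMap, exp_mul_I, ofReal_cos, ofReal_sin]
  have e1 : ∫⁻ w in Metric.ball z 1, ‖g w‖ₑ =
      ∫⁻ w, (Metric.ball (0 : ℂ) 1).indicator (fun w => ‖g (z + w)‖ₑ) w := by
    rw [← lintegral_indicator Metric.isOpen_ball.measurableSet, ← lintegral_add_left_eq_self _ z]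
    refine lintegral_congr fun w => ?_
    simp [Set.indicator, dist_eq_norm]
  rw [e1, ← Complex.lintegral_comp_polarCoord_symm, polarCoord_target,
    Measure.volume_eq_prod, ← Measure.prod_restrict,
    lintegral_prod _ (by
      refine Measurable.aemeasurable ?_
      refine Measurable.mul (by fun_prop) ?_
      refine @Measurable.comp _ _ _ _ Complex.measurableSpace _
        ((Metric.ball (0 : ℂ) 1).indicator (fun w => ‖g (z + w)‖ₑ)) _ ?_ ?_
      · exact Measurable.indicator
          (hcont.comp (continuous_const.add continuous_id)).enorm.measurable
          Metric.isOpen_ball.measurableSet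
      · rw [show (Complex.polarCoord.symm : ℝ × ℝ → ℂ) = _ from
          funext Complex.polarCoord_symm_apply]
        fun_prop)]
  calc ENNReal.ofReal Real.pi * ‖g z‖ₑ
      = ∫⁻ r in Set.Ioo (0:ℝ) 1, ENNReal.ofReal r * (ENNReal.ofReal (2 * Real.pi) * ‖g z‖ₑ) := by
        rw [lintegral_mul_const _ (by fun_prop), ← ofReal_integral_eq_lintegral_ofReal,
          ← integral_Ioc_eq_integral_Ioo, ← intervalIntegral.integral_of_le zero_le_one,
          integral_id, ← mul_assoc, ← ENNReal.ofReal_mul (by norm_num)]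
        · congr 2; ring
        · exact (continuous_id.integrableOn_Icc (a := (0:ℝ)) (b := 1)).mono_set Set.Ioo_subset_Icc_self
        · exact (ae_restrict_iff' measurableSet_Ioo).2 (.of_forall fun x hx => hx.1.le)
    _ ≤ ∫⁻ r in Set.Ioo (0:ℝ) 1, ∫⁻ θ in Set.Ioo (-Real.pi) Real.pi,
          ENNReal.ofReal r * (Metric.ball (0 : ℂ) 1).indicator (fun w => ‖g (z + w)‖ₑ)
            (Complex.polarCoord.symm (r, θ)) := by
        refine setLIntegral_mono' measurableSet_Ioo fun r hr => ?_
        rw [lintegral_const_mul' _ _ ENNReal.ofReal_ne_top]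
        gcongr
        refine (key r).trans (le_of_eq (lintegral_congr fun θ => ?_))
        have hm : Complex.polarCoord.symm (r, θ) ∈ Metric.ball (0 : ℂ) 1 := by
          simp only [mem_ball_zero_iff, Complex.norm_polarCoord_symm, abs_of_pos hr.1]; exact hr.2
        rw [Set.indicator_of_mem hm, Complex.polarCoord_symm_apply]
    _ ≤ _ := lintegral_mono_set Set.Ioo_subset_Ioi_self
/-- The Gaussian measure `(π ℏ)⁻¹ exp (-|z|² / ℏ) dA(z)` on `ℂ`. -/
noncomputable def fockMeasure (ℏ : ℝ) : Measure ℂ :=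
  volume.withDensity fun z => ENNReal.ofReal (Real.exp (-‖z‖ ^ 2 / ℏ) / (Real.pi * ℏ))

/-- Point evaluations of entire functions are bounded by the Fock norm, locally uniformly. -/
theorem exists_enorm_le_mul_eLpNorm_fockMeasure {ℏ : ℝ} (h : 0 < ℏ) (R : ℝ) :
    ∃ C : ℝ≥0∞, C ≠ ∞ ∧ ∀ g : ℂ → ℂ, Differentiable ℂ g → ∀ z ∈ Metric.ball (0 : ℂ) R,
      ‖g z‖ₑ ≤ C * eLpNorm g 2 (fockMeasure ℏ) := by
  set c : ℝ := Real.exp (-(R + 1) ^ 2 / ℏ) / (Real.pi * ℏ) with hc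
  have hc0 : 0 < c := by positivity
  have hC0 : ENNReal.ofReal c ≠ 0 := by simpa using hc0
  refine ⟨(ENNReal.ofReal Real.pi)⁻¹ * (((ENNReal.ofReal c)⁻¹ ^ (1 / (2 : ℝ))) *
    (ENNReal.ofReal Real.pi) ^ (1 / (2 : ℝ))), ?_, ?_⟩
  · refine ENNReal.mul_ne_top (by simp [Real.pi_pos]) (ENNReal.mul_ne_top ?_ ?_)
    · exact ENNReal.rpow_ne_top_of_nonneg (by norm_num) (by simp [hc0])
    · exact ENNReal.rpow_ne_top_of_nonneg (by norm_num) (by simp)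
  intro g hg z hz
  have hz' : ‖z‖ < R := by simpa using hz
  have hmeas : volume.restrict (Metric.ball z 1) ≤
      (ENNReal.ofReal c)⁻¹ • fockMeasure ℏ := by
    refine Measure.le_iff.2 fun s hs => ?_
    rw [Measure.restrict_apply hs, Measure.smul_apply, smul_eq_mul,
      ← ENNReal.mul_le_iff_le_inv hC0 ENNReal.ofReal_ne_top,
      fockMeasure, withDensity_apply _ hs, ← setLIntegral_const]
    refine le_trans ?_ (lintegral_mono_set (Set.inter_subset_left (t := Metric.ball z 1)))
    refine setLIntegral_mono' (hs.inter Metric.isOpen_ball.measurableSet) fun w hw => ?_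
    refine ENNReal.ofReal_le_ofReal ?_
    have h1 : ‖w‖ ≤ R + 1 := by
      have h2 : ‖w - z‖ < 1 := by simpa [dist_eq_norm] using hw.2
      calc ‖w‖ = ‖(w - z) + z‖ := by simp
        _ ≤ ‖w - z‖ + ‖z‖ := norm_add_le _ _
        _ ≤ R + 1 := by linarith
    rw [hc]
    gcongr
  have hvol : (volume.restrict (Metric.ball z 1)) Set.univ = ENNReal.ofReal Real.pi := by
    simp [Complex.volume_ball, ENNReal.ofReal, Real.toNNReal_of_nonneg Real.pi_pos.le]
    rfl
  have h1 := pi_mul_enorm_le_setLIntegral_ball hg z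
  rw [← eLpNorm_one_eq_lintegral_enorm] at h1
  have h2 := eLpNorm_le_eLpNorm_mul_rpow_measure_univ (p := 1) (q := 2)
    (μ := volume.restrict (Metric.ball z 1)) (f := g) (by norm_num)
    hg.continuous.aestronglyMeasurable
  have h3 : eLpNorm g 2 (volume.restrict (Metric.ball z 1)) ≤
      (ENNReal.ofReal c)⁻¹ ^ (1 / (2 : ℝ)) * eLpNorm g 2 (fockMeasure ℏ) := by
    refine (eLpNorm_mono_measure g hmeas).trans (le_of_eq ?_)
    rw [eLpNorm_smul_measure_of_ne_top (by norm_num)]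
    simp
  have hpi : ENNReal.ofReal Real.pi ≠ 0 := by simp [Real.pi_pos]
  rw [mul_assoc, ← ENNReal.mul_le_iff_le_inv hpi ENNReal.ofReal_ne_top]
  refine h1.trans (h2.trans ?_)
  rw [hvol]
  calc _ ≤ ((ENNReal.ofReal c)⁻¹ ^ (1 / (2 : ℝ)) * eLpNorm g 2 (fockMeasure ℏ)) *
        ENNReal.ofReal Real.pi ^ (1 / ENNReal.toReal 1 - 1 / ENNReal.toReal 2) := by gcongr
    _ = _ := by norm_num; ring

/-- The Fock space: the classes in `L²(ℂ, (π ℏ)⁻¹ exp (-|z|² / ℏ) dA)` that have an entire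
representative. -/
noncomputable def fockSpace (ℏ : ℝ) : Submodule ℂ (Lp ℂ 2 (fockMeasure ℏ)) where
  carrier := {u | ∃ g : ℂ → ℂ, Differentiable ℂ g ∧ u =ᵐ[fockMeasure ℏ] g}
  zero_mem' := ⟨0, differentiable_const 0, Lp.coeFn_zero _ _ _⟩
  add_mem' := by
    rintro u v ⟨g, hg, hu⟩ ⟨k, hk, hv⟩
    exact ⟨g + k, hg.add hk, (Lp.coeFn_add u v).trans (hu.add hv)⟩
  smul_mem' := by
    rintro c u ⟨g, hg, hu⟩
    exact ⟨c • g, hg.const_smul c, (Lp.coeFn_smul c u).trans (hu.const_smul c)⟩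

theorem isClosed_fockSpace {ℏ : ℝ} (h : 0 < ℏ) :
    IsClosed (fockSpace ℏ : Set (Lp ℂ 2 (fockMeasure ℏ))) := by
  refine IsSeqClosed.isClosed fun u v hu huv => ?_
  choose g hg hug using hu
  have hcau : ∀ R : ℝ, UniformCauchySeqOn g Filter.atTop (Metric.ball (0 : ℂ) R) := by
    intro R
    obtain ⟨C, hC, hle⟩ := exists_enorm_le_mul_eLpNorm_fockMeasure h R
    rw [Metric.uniformCauchySeqOn_iff]
    intro ε hε
    have hu' := Metric.cauchySeq_iff.1 huv.cauchySeq (ε / (C.toReal + 1)) (by positivity)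
    obtain ⟨N, hN⟩ := hu'
    refine ⟨N, fun m hm n hn z hz => ?_⟩
    have h1 := hle (g m - g n) ((hg m).sub (hg n)) z hz
    have h2 : eLpNorm (g m - g n) 2 (fockMeasure ℏ) = ‖u m - u n‖ₑ := by
      rw [Lp.enorm_def]
      exact eLpNorm_congr_ae ((Lp.coeFn_sub _ _).trans ((hug m).sub (hug n))).symm
    rw [h2] at h1
    have h3 : ‖(g m - g n) z‖ ≤ C.toReal * ‖u m - u n‖ := by
      have := ENNReal.toReal_mono (ENNReal.mul_ne_top hC enorm_ne_top) h1
      simpa [ENNReal.toReal_mul, toReal_enorm] using this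
    have h4 := hN m hm n hn
    rw [dist_eq_norm] at h4 ⊢
    have h5 : 0 ≤ C.toReal := ENNReal.toReal_nonneg
    calc ‖g m z - g n z‖ ≤ C.toReal * ‖u m - u n‖ := h3
      _ ≤ C.toReal * (ε / (C.toReal + 1)) := by gcongr
      _ < (C.toReal + 1) * (ε / (C.toReal + 1)) := by
          have : 0 < ε / (C.toReal + 1) := by positivity
          linarith
      _ = ε := by field_simp
  have hlim : ∀ z, ∃ y, Filter.Tendsto (fun n => g n z) Filter.atTop (nhds y) := fun z =>
    cauchySeq_tendsto_of_complete ((hcau (‖z‖ + 1)).cauchySeq (by simp))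
  choose G hG using hlim
  have hGd : Differentiable ℂ G := by
    rw [← differentiableOn_univ]
    refine TendstoLocallyUniformlyOn.differentiableOn (F := g) (φ := Filter.atTop) ?_
      (.of_forall fun n => (hg n).differentiableOn) isOpen_univ
    rw [tendstoLocallyUniformlyOn_univ]
    refine tendstoLocallyUniformly_iff_forall_isCompact.2 fun K hK => ?_
    obtain ⟨R, hR⟩ := hK.isBounded.subset_ball (0 : ℂ)
    exact ((hcau R).tendstoUniformlyOn_of_tendsto fun z _ => hG z).mono hR
  refine ⟨G, hGd, ?_⟩
  obtain ⟨ns, hns, hae⟩ := (tendstoInMeasure_of_tendsto_Lp huv).exists_seq_tendsto_ae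
  filter_upwards [hae, ae_all_iff.2 hug] with z hz hz'
  refine tendsto_nhds_unique hz ?_
  simp only [hz']
  exact (hG z).comp hns.tendsto_atTop

end FockSpace

/-! ### Toeplitz operators on closed subspaces of `L²` -/

section Toeplitz

variable {X : Type*} [MeasurableSpace X] {ν : Measure X}

open Classical in
/-- The Toeplitz operator `u ↦ 𝒫 (F u)` on a subspace `W` of `L²(ν)` with symbol `F ∈ L^∞(ν)`, where
`𝒫 : L²(ν) → W` is the orthogonal projection (and `0` if `F` is not in `L^∞(ν)`). -/
noncomputable def toeplitz (W : Submodule ℂ (Lp ℂ 2 ν)) [W.HasOrthogonalProjection] (F : X → ℂ) :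
    W →L[ℂ] W :=
  if hF : MemLp F ⊤ ν then
    W.orthogonalProjectionOnto ∘L
      ((ContinuousLinearMap.mul ℂ ℂ).holderL ν ⊤ 2 2 hF.toLp) ∘L W.subtypeL
  else 0

/-- A complete subspace `W` of `L²(ν)` with a structure of a Hilbert space of functions on `X` is,
with the inner product of `L²(ν)`, a reproducing kernel Hilbert space with kernel `K`: the function
attached to an element of `W` is a representative of it, and the kernel is `K`. -/
def IsRKHSWithKernel (W : Submodule ℂ (Lp ℂ 2 ν)) [CompleteSpace W] [RKHS ℂ W X ℂ]
    (K : X → X → ℂ) : Prop :=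
  (∀ u : W, ((u : Lp ℂ 2 ν) : X → ℂ) =ᵐ[ν] RKHS.coeCLM ℂ u) ∧
    ∀ x y : X, RKHS.kernel W x y 1 = K x y

end Toeplitz

/-! ### Wirtinger derivatives and the coefficients of the star product on `ℂ` -/

/-- `∂f/∂z`. -/
noncomputable def dz (f : ℂ → ℂ) (z : ℂ) : ℂ :=
  (fderiv ℝ f z 1 - Complex.I * fderiv ℝ f z Complex.I) / 2

/-- `∂f/∂z̄`. -/
noncomputable def dzbar (f : ℂ → ℂ) (z : ℂ) : ℂ :=
  (fderiv ℝ f z 1 + Complex.I * fderiv ℝ f z Complex.I) / 2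

/-- `C̃_j(f, g) = (-1)^j / j! · ∂^j f/∂z^j · ∂^j g/∂z̄^j`. -/
noncomputable def starCoeff (j : ℕ) (f g : ℂ → ℂ) (z : ℂ) : ℂ :=
  (-1) ^ j / (j.factorial : ℂ) * dz^[j] f z * dzbar^[j] g z

/-! ### The degenerate noncommutative coherent states -/

/-- A point `((q₁, p₁), (q₂, p₂))` of the phase space `ℝ⁴`. -/
abbrev Phase := (ℝ × ℝ) × (ℝ × ℝ)

/-- The parameters: `ℏ`, `ϑ`, the labels `κ, δ` of the representation, and the width `s` of the
Gaussian ground state. In the degenerate case `ℬ = ℏ² / ϑ`. -/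
structure Params where
  ℏ : ℝ
  ϑ : ℝ
  κ : ℝ
  δ : ℝ
  s : ℝ
  ℏ_pos : 0 < ℏ
  ϑ_ne : ϑ ≠ 0
  s_pos : 0 < s

instance (P : Params) : CompleteSpace (fockSpace P.ℏ) :=
  (isClosed_fockSpace P.ℏ_pos).completeSpace_coe

namespace Params

variable (P : Params)

/-- The normalized Gaussian ground state `η̃`. -/
noncomputable def groundState (r : ℝ) : ℝ :=
  1 / (Real.pi ^ (1 / 4 : ℝ) * P.s ^ (1 / 2 : ℝ)) * Real.exp (-r ^ 2 / (2 * P.s ^ 2))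

/-- The degenerate noncommutative coherent state `η̃_{q,p}`. -/
noncomputable def coherentState : Phase → ℝ → ℂ
  | ((q₁, p₁), (q₂, p₂)), r =>
    Complex.exp (Complex.I * ((-P.κ * q₁ - P.δ * q₂ - r / P.ℏ * (p₁ + P.ℏ / P.ϑ * q₂)
      - 1 / (2 * P.ℏ) * (q₁ * p₁ - q₂ * p₂)
      + 1 / 2 * (-(q₁ * q₂) / P.ϑ + P.ϑ / P.ℏ ^ 2 * (p₁ * p₂)) : ℝ) : ℂ)) *
      (P.groundState (r + q₁ - P.ϑ / P.ℏ * p₂) : ℂ)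

/-- The kernel `K̃(x, y) = ⟨η̃_x | η̃_y⟩`, the inner product being that of `L²(ℝ)`. -/
noncomputable def kernel (x y : Phase) : ℂ :=
  ∫ r : ℝ, starRingEnd ℂ (P.coherentState x r) * P.coherentState y r

/-- The measure `dν̃ = (2πℏ)⁻¹ dq₁ dp₁ dμ(q₂, p₂)`. -/
noncomputable def nu (μ : Measure (ℝ × ℝ)) : Measure Phase :=
  ENNReal.ofReal (1 / (2 * Real.pi * P.ℏ)) • (volume : Measure (ℝ × ℝ)).prod μ

/-- The closed subspace of `L²(ν̃)` generated by the functions `K̃(·, y)`. -/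
noncomputable def rkSpace (μ : Measure (ℝ × ℝ)) : Submodule ℂ (Lp ℂ 2 (P.nu μ)) :=
  (Submodule.span ℂ {u : Lp ℂ 2 (P.nu μ) |
    ∃ y : Phase, u =ᵐ[P.nu μ] fun x => P.kernel x y}).topologicalClosure

instance (μ : Measure (ℝ × ℝ)) : CompleteSpace (P.rkSpace μ) :=
  Submodule.topologicalClosure.completeSpace _

/-- `q₁^NC = q₁ - (ϑ/ℏ) p₂`. -/
noncomputable def qNC (x : Phase) : ℝ := x.1.1 - P.ϑ / P.ℏ * x.2.2

/-- `p₁^NC = p₁ + (ℏ/ϑ) q₂ + 2κℏ`. -/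
noncomputable def pNC (x : Phase) : ℝ := x.1.2 + P.ℏ / P.ϑ * x.2.1 + 2 * P.κ * P.ℏ

/-- `z^NC = √(ℏ/2) q₁^NC / s - i s p₁^NC / √(2ℏ)`. -/
noncomputable def zNC (x : Phase) : ℂ :=
  ((√(P.ℏ / 2) * P.qNC x / P.s : ℝ) : ℂ) -
    Complex.I * ((P.s * P.pNC x / √(2 * P.ℏ) : ℝ) : ℂ)

/-- The function `Ṽ g`. -/
noncomputable def transform (g : ℂ → ℂ) (x : Phase) : ℂ :=
  Complex.exp (Complex.I * ((P.δ * x.2.1 + P.κ * P.ϑ * x.2.2 / P.ℏ : ℝ) : ℂ)) *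
    (Real.exp (-‖P.zNC x‖ ^ 2 / (2 * P.ℏ)) : ℂ) * g (P.zNC x)

/-- `ϱF(z)`: the average of `F` over `(q₂, p₂)` with respect to `μ`, with
`q₁^NC = s (z + z̄) / √(2ℏ)` and `p₁^NC = √(ℏ/2) (z̄ - z) / (i s)` fixed. -/
noncomputable def rho (μ : Measure (ℝ × ℝ)) (F : Phase → ℂ) (z : ℂ) : ℂ :=
  ∫ y : ℝ × ℝ, F ((P.s / √(2 * P.ℏ) * (2 * z.re) + P.ϑ / P.ℏ * y.2,
    √(P.ℏ / 2) / P.s * (-2 * z.im) - P.ℏ / P.ϑ * y.1 - 2 * P.κ * P.ℏ), y) ∂μ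

/-- `ϱ*f(q, p) = f(z^NC)`. -/
noncomputable def rhoStar (f : ℂ → ℂ) (x : Phase) : ℂ := f (P.zNC x)

/-- `t` is a right inverse of `ϱ : L^∞(ℝ⁴, ν̃) → L^∞(ℂ)`. -/
def IsRightInverse (μ : Measure (ℝ × ℝ)) (t : (ℂ → ℂ) → Phase → ℂ) : Prop :=
  ∀ f : ℂ → ℂ, MemLp f ⊤ (volume : Measure ℂ) →
    MemLp (t f) ⊤ (P.nu μ) ∧ P.rho μ (t f) =ᵐ[volume] f

end Params

end DegenerateNC

/-! The coordinates `(z, y)` with `z = z^NC` and `y = (q₂, p₂)` untangle everything. In them `ν̃`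
becomes the product of `(πℏ)⁻¹ dA` and `μ`, and the coherent states depend on `y` only through a
unimodular factor. One Gaussian integral then gives `K̃(x, y) = weight x · conj (weight y) · exp (z
w̄ / ℏ)`, with `z`, `w` the values of `z^NC` at `x`, `y`: the Fock kernel, up to a nowhere vanishing
factor whose squared modulus is the Gaussian density. Hence multiplying by `weight` and pulling back
along `z^NC` is isometric and carries the kernel vectors of the Fock space to multiples of the
functions `K̃(·, y)`; it is therefore unitary between the closed spans. In a matrix element of `F`
only `F` depends on `y`, so integrating over `y` first replaces `F` by `ϱF`.

For the expansion, Fourier inversion writes `F` as a superposition of characters of `ℝ⁴` with a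
Schwartz amplitude `ψ`. The chart is affine in `z` with linear part independent of `y`, so `ϱ` turns
each character into a plane wave `wave (a ξ)` times a number of modulus at most one. On the Fock
space `T_a`, the Toeplitz operator of `wave a`, is a weighted translation, with `T_a T_b = exp (ℏ ā
b) T_{a+b}` (`toeplitz_wave_comp`) and `‖T_a u‖ = exp (-ℏ|a|²/2) ‖u‖` (`norm_toeplitz_wave_apply`).
The Taylor terms of `exp (ℏ ā b)` are exactly the star product coefficients on plane waves. The
Taylor remainder may grow like `exp (Re ℏ ā b)`, but the Gaussian decay of `T_{a+b}` absorbs this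
(`max_exp_mul_norm_inner_toeplitz_wave_le`), leaving `ℏ^(N+1) |a|^(N+1) |b|^(N+1)`, which is
integrable against Schwartz amplitudes.

The constant is uniform because `ϑ`, `κ` and `μ` enter the amplitudes only through averages of
phases, `δ` does not enter `ϱ` at all, and for `s = S√ℏ` the map `ξ ↦ a ξ` depends on `S` alone. -/

namespace DegenerateNC

/-! ### The Gaussian measure and the reproducing formula -/

section Gaussian

open Complex

theorem measurable_fockDensity (ℏ : ℝ) :
    Measurable fun z : ℂ => ENNReal.ofReal (Real.exp (-‖z‖ ^ 2 / ℏ) / (Real.pi * ℏ)) := by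
  fun_prop

theorem toReal_fockDensity {ℏ : ℝ} (h : 0 < ℏ) (z : ℂ) :
    (ENNReal.ofReal (Real.exp (-‖z‖ ^ 2 / ℏ) / (Real.pi * ℏ))).toReal =
      Real.exp (-‖z‖ ^ 2 / ℏ) / (Real.pi * ℏ) :=
  ENNReal.toReal_ofReal (by positivity)

theorem integral_fockMeasure {ℏ : ℝ} (h : 0 < ℏ) (f : ℂ → ℂ) :
    ∫ z, f z ∂fockMeasure ℏ =
      ∫ z, ((Real.exp (-‖z‖ ^ 2 / ℏ) / (Real.pi * ℏ) : ℝ) : ℂ) * f z := by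
  rw [fockMeasure, integral_withDensity_eq_integral_toReal_smul₀
    (measurable_fockDensity ℏ).aemeasurable (by simp)]
  simp_rw [toReal_fockDensity h, real_smul]

theorem integrable_fockMeasure_iff {ℏ : ℝ} (h : 0 < ℏ) {f : ℂ → ℂ} :
    Integrable f (fockMeasure ℏ) ↔
      Integrable (fun z => ((Real.exp (-‖z‖ ^ 2 / ℏ) / (Real.pi * ℏ) : ℝ) : ℂ) * f z) := by
  rw [fockMeasure, integrable_withDensity_iff_integrable_smul'
    (measurable_fockDensity ℏ) (by simp)]
  simp_rw [toReal_fockDensity h, real_smul]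

theorem fockMeasure_absolutelyContinuous (ℏ : ℝ) : fockMeasure ℏ ≪ volume :=
  withDensity_absolutelyContinuous _ _

theorem absolutelyContinuous_fockMeasure {ℏ : ℝ} (h : 0 < ℏ) : volume ≪ fockMeasure ℏ := by
  refine withDensity_absolutelyContinuous' (measurable_fockDensity ℏ).aemeasurable
    (.of_forall fun z => ?_)
  have : 0 < Real.exp (-‖z‖ ^ 2 / ℏ) / (Real.pi * ℏ) := by positivity
  simpa using this

theorem integral_exp_neg_norm_sq_div {ℏ : ℝ} (h : 0 < ℏ) :
    ∫ z : ℂ, Real.exp (-‖z‖ ^ 2 / ℏ) = Real.pi * ℏ := by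
  have := GaussianFourier.integral_rexp_neg_mul_sq_norm (V := ℂ) (inv_pos.2 h)
  simp only [finrank_real_complex] at this
  norm_num at this
  rw [← this]
  congr 1 with z
  congr 1
  ring

theorem integrable_exp_neg_norm_sq_div {ℏ : ℝ} (h : 0 < ℏ) :
    Integrable fun z : ℂ => Real.exp (-‖z‖ ^ 2 / ℏ) := by
  by_contra hn
  have := integral_exp_neg_norm_sq_div h
  rw [integral_undef hn] at this
  have : 0 < Real.pi * ℏ := by positivity
  linarith

theorem isProbabilityMeasure_fockMeasure {ℏ : ℝ} (h : 0 < ℏ) :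
    IsProbabilityMeasure (fockMeasure ℏ) := by
  constructor
  rw [fockMeasure, withDensity_apply _ MeasurableSet.univ, Measure.restrict_univ,
    ← ofReal_integral_eq_lintegral_ofReal
      ((integrable_exp_neg_norm_sq_div h).div_const _) (.of_forall fun z => by positivity),
    integral_div, integral_exp_neg_norm_sq_div h, div_self (by positivity), ENNReal.ofReal_one]

/-- Only `d = a + conj b` matters for the modulus, and completing the square turns the weighted
squared modulus into a multiple of the Gaussian centred at `ℏ conj d`. -/
theorem memLp_exp_linear {ℏ : ℝ} (h : 0 < ℏ) (a b : ℂ) :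
    MemLp (fun z => exp (a * z + b * starRingEnd ℂ z)) 2 (fockMeasure ℏ) := by
  have hm : Continuous fun z => exp (a * z + b * starRingEnd ℂ z) :=
    continuous_exp.comp ((continuous_const.mul continuous_id).add
      (continuous_const.mul continuous_conj))
  refine (memLp_two_iff_integrable_sq_norm hm.aestronglyMeasurable).2 ?_
  rw [fockMeasure, integrable_withDensity_iff_integrable_smul'
    (measurable_fockDensity ℏ) (by simp)]
  simp_rw [toReal_fockDensity h]
  set d := a + starRingEnd ℂ b with hd
  have key := (((integrable_exp_neg_norm_sq_div h).comp_sub_right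
    (ℏ * starRingEnd ℂ d)).const_mul (Real.exp (ℏ * ‖d‖ ^ 2))).div_const (Real.pi * ℏ)
  refine key.congr (.of_forall fun z => ?_)
  simp only [smul_eq_mul]
  rw [norm_exp, ← Real.exp_add, div_mul_eq_mul_div, ← Real.exp_nat_mul, ← Real.exp_add]
  congr 2
  rw [← normSq_eq_norm_sq, ← normSq_eq_norm_sq, ← normSq_eq_norm_sq]
  simp only [normSq_apply, hd, sub_re, sub_im, mul_re, mul_im, add_re, add_im, conj_re, conj_im,
    ofReal_re, ofReal_im, Nat.cast_ofNat]
  field_simp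
  ring

theorem measurePreserving_mul_fockMeasure (ℏ : ℝ) (c : Circle) :
    MeasurePreserving (fun z : ℂ => (c : ℂ) * z) (fockMeasure ℏ) (fockMeasure ℏ) := by
  have hvol : MeasurePreserving (fun z : ℂ => (c : ℂ) * z) volume volume :=
    (rotation c).measurePreserving
  refine ⟨hvol.measurable, Measure.ext fun s hs => ?_⟩
  rw [Measure.map_apply hvol.measurable hs, fockMeasure,
    withDensity_apply _ (hvol.measurable hs), withDensity_apply _ hs,
    ← hvol.setLIntegral_comp_preimage hs (measurable_fockDensity ℏ)]
  simp only [norm_mul, Circle.norm_coe, one_mul]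

/-- The mean value property over the Gaussian measure. -/
theorem integral_fockMeasure_of_differentiable {ℏ : ℝ} (h : 0 < ℏ) {f : ℂ → ℂ}
    (hf : Differentiable ℂ f) (hi : Integrable f (fockMeasure ℏ)) :
    ∫ z, f z ∂fockMeasure ℏ = f 0 := by
  have := isProbabilityMeasure_fockMeasure h
  -- The rotated integrand is averaged over the angle in both orders: rotation invariance of the
  -- measure gives the integral of `f`, the circle mean value property gives `f 0`.
  have hrot : ∀ θ : ℝ, ∫ z, f (circleMap 0 1 θ * z) ∂fockMeasure ℏ = ∫ z, f z ∂fockMeasure ℏ := by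
    intro θ
    have hc : circleMap 0 1 θ = (Circle.exp θ : ℂ) := by simp [circleMap]
    rw [hc]
    exact (measurePreserving_mul_fockMeasure ℏ (Circle.exp θ)).integral_comp
      (rotation (Circle.exp θ)).toHomeomorph.measurableEmbedding f
  have hmean : ∀ z : ℂ, ∫ θ in (0)..(2 * Real.pi), f (circleMap 0 1 θ * z) =
      (2 * Real.pi : ℝ) * f 0 := by
    intro z
    have h1 : Real.circleAverage (fun w => f (w * z)) 0 1 = f (0 * z) :=
      (Differentiable.diffContOnCl (f := fun w => f (w * z)) (by fun_prop)).circleAverage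
    rw [Real.circleAverage_def, zero_mul] at h1
    rw [← h1, real_smul, ← mul_assoc, ← ofReal_mul, mul_inv_cancel₀ (by positivity), ofReal_one,
      one_mul]
  have hfin : IsFiniteMeasure (volume.restrict (Set.uIoc 0 (2 * Real.pi))) := by
    rw [Set.uIoc_of_le (by positivity)]
    infer_instance
  -- Joint integrability comes for free: `(θ, z) ↦ (θ, e^{iθ} z)` preserves the product measure and
  -- pulls the integrable function `f p.2` back to this one.
  have hint : Integrable (fun p : ℝ × ℂ => f (circleMap 0 1 p.1 * p.2))
      ((volume.restrict (Set.uIoc 0 (2 * Real.pi))).prod (fockMeasure ℏ)) := by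
    have hsk : MeasurePreserving (fun p : ℝ × ℂ => (p.1, circleMap 0 1 p.1 * p.2))
        ((volume.restrict (Set.uIoc 0 (2 * Real.pi))).prod (fockMeasure ℏ))
        ((volume.restrict (Set.uIoc 0 (2 * Real.pi))).prod (fockMeasure ℏ)) := by
      refine (MeasurePreserving.id _).skew_product (g := fun θ z => circleMap 0 1 θ * z) ?_
        (.of_forall fun θ => ?_)
      · exact ((continuous_circleMap 0 1).comp continuous_fst |>.mul continuous_snd).measurable
      · have hc : circleMap 0 1 θ = (Circle.exp θ : ℂ) := by simp [circleMap]
        rw [hc]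
        exact (measurePreserving_mul_fockMeasure ℏ (Circle.exp θ)).map_eq
    have h2 : Integrable (fun p : ℝ × ℂ => f p.2)
        ((volume.restrict (Set.uIoc 0 (2 * Real.pi))).prod (fockMeasure ℏ)) := hi.comp_snd _
    exact hsk.integrable_comp_of_integrable h2
  have hswap := intervalIntegral_integral_swap
    (f := fun θ z => f (circleMap 0 1 θ * z)) hint
  simp only [hrot, hmean, intervalIntegral.integral_const, integral_const, probReal_univ,
    one_smul, sub_zero, real_smul] at hswap
  have h2pi : ((2 * Real.pi : ℝ) : ℂ) ≠ 0 := by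
    exact_mod_cast (by positivity : (2 * Real.pi : ℝ) ≠ 0)
  exact mul_left_cancel₀ h2pi hswap

/-- Expanding `|z + w|²`, the antiholomorphic factor `exp (w z̄ / ℏ)` cancels. After a translation
by `w`, the reproducing integral thus has an entire integrand and reduces to the mean value
property. -/
theorem fockDensity_add_mul_exp {ℏ : ℝ} (h : 0 < ℏ) (w z : ℂ) :
    ((Real.exp (-‖z + w‖ ^ 2 / ℏ) / (Real.pi * ℏ) : ℝ) : ℂ) * exp (w * starRingEnd ℂ (z + w) / ℏ) =
      ((Real.exp (-‖z‖ ^ 2 / ℏ) / (Real.pi * ℏ) : ℝ) : ℂ) * exp (-z * starRingEnd ℂ w / ℏ) := by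
  have hc : (ℏ : ℂ) ≠ 0 := by exact_mod_cast h.ne'
  push_cast
  rw [div_mul_eq_mul_div, div_mul_eq_mul_div, ← exp_add, ← exp_add]
  congr 2
  have e : ∀ u : ℂ, ((‖u‖ : ℂ)) ^ 2 = u * starRingEnd ℂ u := fun u => by
    rw [mul_conj, normSq_eq_norm_sq]; push_cast; rfl
  rw [e, e, map_add]
  field_simp
  ring

/-- The reproducing formula of the Fock space. -/
theorem integral_mul_exp_fockMeasure {ℏ : ℝ} (h : 0 < ℏ) {f : ℂ → ℂ} (hf : Differentiable ℂ f)
    (w : ℂ) (hi : Integrable (fun z => exp (w * starRingEnd ℂ z / ℏ) * f z) (fockMeasure ℏ)) :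
    ∫ z, exp (w * starRingEnd ℂ z / ℏ) * f z ∂fockMeasure ℏ = f w := by
  have e : ∀ z : ℂ, ((Real.exp (-‖z + w‖ ^ 2 / ℏ) / (Real.pi * ℏ) : ℝ) : ℂ) *
      (exp (w * starRingEnd ℂ (z + w) / ℏ) * f (z + w)) =
      ((Real.exp (-‖z‖ ^ 2 / ℏ) / (Real.pi * ℏ) : ℝ) : ℂ) *
        (exp (-z * starRingEnd ℂ w / ℏ) * f (z + w)) := fun z => by
    rw [← mul_assoc, fockDensity_add_mul_exp h, mul_assoc]
  have hi' : Integrable (fun z => exp (-z * starRingEnd ℂ w / ℏ) * f (z + w)) (fockMeasure ℏ) := by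
    rw [integrable_fockMeasure_iff h] at hi ⊢
    simpa only [e] using hi.comp_add_right w
  have hd : Differentiable ℂ fun z => exp (-z * starRingEnd ℂ w / ℏ) * f (z + w) := by
    fun_prop
  have := integral_fockMeasure_of_differentiable h hd hi'
  simp only [neg_zero, zero_mul, zero_div, exp_zero, one_mul, zero_add] at this
  rw [← this, integral_fockMeasure h, integral_fockMeasure h, ← integral_add_right_eq_self _ w]
  simp only [e]

end Gaussian

/-! ### Matrix elements of Toeplitz operators -/

section ToeplitzMatrixElements

variable {X : Type*} [MeasurableSpace X] {ν : Measure X}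

theorem integrable_conj_mul_mul {F : X → ℂ} (hF : MemLp F ⊤ ν) (v u : Lp ℂ 2 ν) :
    Integrable (fun x => starRingEnd ℂ (v x) * (F x * u x)) ν := by
  have h1 : MemLp (fun x => F x * u x) 2 ν := (Lp.memLp u).mul hF
  exact (Lp.memLp v).star.integrable_mul h1

/-- The projection is self-adjoint and fixes `v`, so it drops out. Operator identities below are
verified on these matrix elements. -/
theorem inner_toeplitz (W : Submodule ℂ (Lp ℂ 2 ν)) [W.HasOrthogonalProjection] {F : X → ℂ}
    (hF : MemLp F ⊤ ν) (v u : W) :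
    inner ℂ v (toeplitz W F u) =
      ∫ x, starRingEnd ℂ ((v : Lp ℂ 2 ν) x) * (F x * (u : Lp ℂ 2 ν) x) ∂ν := by
  rw [toeplitz, dif_pos hF]
  simp only [ContinuousLinearMap.comp_apply, Submodule.subtypeL_apply]
  rw [Submodule.inner_orthogonalProjectionOnto_eq_of_mem_left, L2.inner_def]
  refine integral_congr_ae ?_
  filter_upwards [(ContinuousLinearMap.mul ℂ ℂ).coeFn_holder (r := 2) hF.toLp (u : Lp ℂ 2 ν),
    hF.coeFn_toLp] with x h1 h2
  rw [ContinuousLinearMap.holderL_apply_apply, h1, h2]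
  simp [mul_comm]

theorem toeplitz_congr_ae (W : Submodule ℂ (Lp ℂ 2 ν)) [W.HasOrthogonalProjection] {F G : X → ℂ}
    (h : F =ᵐ[ν] G) : toeplitz W F = toeplitz W G := by
  by_cases hF : MemLp F ⊤ ν
  · have hG : MemLp G ⊤ ν := (memLp_congr_ae h).1 hF
    refine ContinuousLinearMap.ext fun u => ext_inner_left ℂ fun v => ?_
    rw [inner_toeplitz W hF, inner_toeplitz W hG]
    refine integral_congr_ae ?_
    filter_upwards [h] with x hx
    rw [hx]
  · have hG : ¬ MemLp G ⊤ ν := fun hG => hF ((memLp_congr_ae h).2 hG)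
    rw [toeplitz, toeplitz, dif_neg hF, dif_neg hG]

end ToeplitzMatrixElements

/-! ### Entire representatives and the reproducing kernel of the Fock space -/

section FockKernel

open Complex

variable {ℏ : ℝ}

/-- The entire representative of an element of the Fock space. -/
noncomputable def entireRep (u : fockSpace ℏ) : ℂ → ℂ := Classical.choose u.2

theorem differentiable_entireRep (u : fockSpace ℏ) : Differentiable ℂ (entireRep u) :=
  (Classical.choose_spec u.2).1

theorem coeFn_ae_eq_entireRep (u : fockSpace ℏ) :
    (u : Lp ℂ 2 (fockMeasure ℏ)) =ᵐ[fockMeasure ℏ] entireRep u :=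
  (Classical.choose_spec u.2).2

theorem memLp_entireRep (u : fockSpace ℏ) : MemLp (entireRep u) 2 (fockMeasure ℏ) :=
  (memLp_congr_ae (coeFn_ae_eq_entireRep u)).1 (Lp.memLp _)

theorem eq_of_ae_eq_fockMeasure (h : 0 < ℏ) {f g : ℂ → ℂ} (hf : Continuous f) (hg : Continuous g)
    (hfg : f =ᵐ[fockMeasure ℏ] g) : f = g :=
  (Continuous.ae_eq_iff_eq volume hf hg).1 ((absolutelyContinuous_fockMeasure h).ae_eq hfg)

theorem entireRep_eq (h : 0 < ℏ) {u : fockSpace ℏ} {g : ℂ → ℂ} (hg : Differentiable ℂ g)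
    (hu : (u : Lp ℂ 2 (fockMeasure ℏ)) =ᵐ[fockMeasure ℏ] g) : entireRep u = g :=
  eq_of_ae_eq_fockMeasure h (differentiable_entireRep u).continuous hg.continuous
    ((coeFn_ae_eq_entireRep u).symm.trans hu)

theorem entireRep_injective : Function.Injective (entireRep (ℏ := ℏ)) := fun u v huv =>
  Subtype.ext (Lp.ext ((coeFn_ae_eq_entireRep u).trans
    (by rw [huv]; exact (coeFn_ae_eq_entireRep v).symm)))

theorem memLp_exp_mul_conj_div (h : 0 < ℏ) (w : ℂ) :
    MemLp (fun z => exp (z * starRingEnd ℂ w / ℏ)) 2 (fockMeasure ℏ) := by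
  convert memLp_exp_linear h (starRingEnd ℂ w / ℏ) 0 using 3
  ring

/-- The kernel function `z ↦ exp (z w̄ / ℏ)` of the Fock space. -/
noncomputable def kernelVec (h : 0 < ℏ) (w : ℂ) : fockSpace ℏ :=
  ⟨(memLp_exp_mul_conj_div h w).toLp, _, by fun_prop, (memLp_exp_mul_conj_div h w).coeFn_toLp⟩

theorem coeFn_kernelVec (h : 0 < ℏ) (w : ℂ) :
    (kernelVec h w : Lp ℂ 2 (fockMeasure ℏ)) =ᵐ[fockMeasure ℏ]
      fun z => exp (z * starRingEnd ℂ w / ℏ) :=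
  (memLp_exp_mul_conj_div h w).coeFn_toLp

theorem entireRep_kernelVec (h : 0 < ℏ) (w : ℂ) :
    entireRep (kernelVec h w) = fun z => exp (z * starRingEnd ℂ w / ℏ) :=
  entireRep_eq h (by fun_prop) (coeFn_kernelVec h w)

/-- Evaluation becomes an inner product; linearity of the chosen representative `entireRep` and the
pointwise action of operators are both read off from this. -/
theorem inner_kernelVec (h : 0 < ℏ) (w : ℂ) (u : fockSpace ℏ) :
    inner ℂ (kernelVec h w) u = entireRep u w := by
  have hi : Integrable (fun z => exp (w * starRingEnd ℂ z / ℏ) * entireRep u z)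
      (fockMeasure ℏ) := by
    refine MemLp.integrable_mul (p := 2) (q := 2) ?_ (memLp_entireRep u)
    convert memLp_exp_linear h 0 (w / ℏ) using 3
    ring
  rw [← integral_mul_exp_fockMeasure h (differentiable_entireRep u) w hi, Submodule.coe_inner,
    L2.inner_def]
  refine integral_congr_ae ?_
  filter_upwards [coeFn_kernelVec h w, coeFn_ae_eq_entireRep u] with z h1 h2
  rw [h1, h2, RCLike.inner_apply, ← exp_conj, map_div₀, map_mul, conj_conj, conj_ofReal, mul_comm,
    mul_comm w]

/-- A vector orthogonal to all kernel vectors has an entire representative vanishing at every point.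
-/
theorem topologicalClosure_span_kernelVec (h : 0 < ℏ) [CompleteSpace (fockSpace ℏ)] :
    (Submodule.span ℂ (Set.range (kernelVec h))).topologicalClosure = ⊤ := by
  rw [Submodule.topologicalClosure_eq_top_iff, Submodule.eq_bot_iff]
  intro u hu
  refine entireRep_injective (funext fun w => ?_)
  rw [← inner_kernelVec h, ← inner_kernelVec h, inner_zero_right]
  exact (Submodule.mem_orthogonal _ _).1 hu _ (Submodule.subset_span ⟨w, rfl⟩)

end FockKernel

/-! ### Toeplitz operators with plane wave symbols -/

section PlaneWaves

open Complex

/-- The plane wave `z ↦ exp (i (a z̄ + ā z))`. -/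
noncomputable def wave (a z : ℂ) : ℂ :=
  exp (I * (a * starRingEnd ℂ z + starRingEnd ℂ a * z))

theorem norm_wave (a z : ℂ) : ‖wave a z‖ = 1 := by
  rw [wave, norm_exp]
  simp only [mul_re, mul_im, add_re, add_im, conj_re, conj_im, I_re, I_im]
  ring_nf
  exact Real.exp_zero

theorem wave_add (a b z : ℂ) : wave (a + b) z = wave a z * wave b z := by
  simp only [wave, ← exp_add, map_add]
  congr 1
  ring

theorem wave_zero (z : ℂ) : wave 0 z = 1 := by simp [wave]

theorem conj_wave (a z : ℂ) : starRingEnd ℂ (wave a z) = wave (-a) z := by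
  simp only [wave, ← exp_conj, map_mul, map_add, conj_I, conj_conj, map_neg]
  congr 1
  ring

theorem continuous_wave : Continuous fun p : ℂ × ℂ => wave p.1 p.2 := by
  unfold wave
  fun_prop

theorem memLp_wave (a : ℂ) (ν : Measure ℂ) : MemLp (wave a) ⊤ ν :=
  memLp_top_of_bound (continuous_wave.comp (Continuous.prodMk_right a)).aestronglyMeasurable 1
    (.of_forall fun z => (norm_wave a z).le)

variable {ℏ : ℝ} [CompleteSpace (fockSpace ℏ)]

/-- The Toeplitz operator whose symbol is a plane wave is a weighted translation. -/
theorem entireRep_toeplitz_wave (h : 0 < ℏ) (a : ℂ) (u : fockSpace ℏ) (z : ℂ) :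
    entireRep (toeplitz (fockSpace ℏ) (wave a) u) z =
      exp (I * starRingEnd ℂ a * (z + I * ℏ * a)) * entireRep u (z + I * ℏ * a) := by
  have hc : (ℏ : ℂ) ≠ 0 := by exact_mod_cast h.ne'
  -- The factor `exp (i a w̄)` of the plane wave merges with the kernel and moves its base point
  -- from `z` to `z + iℏa`; what remains is entire, so the reproducing formula applies at the new
  -- point.
  have hd : Differentiable ℂ fun w => exp (I * starRingEnd ℂ a * w) * entireRep u w :=
    Differentiable.mul (by fun_prop) (differentiable_entireRep u)
  have hi : Integrable (fun w => exp ((z + I * ℏ * a) * starRingEnd ℂ w / ℏ) *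
      (exp (I * starRingEnd ℂ a * w) * entireRep u w)) (fockMeasure ℏ) := by
    have h1 := (memLp_exp_linear h (I * starRingEnd ℂ a) ((z + I * ℏ * a) / ℏ)).integrable_mul
      (memLp_entireRep u)
    refine h1.congr (.of_forall fun w => ?_)
    simp only [Pi.mul_apply]
    rw [← mul_assoc, ← exp_add]
    congr 2
    ring
  rw [← inner_kernelVec h, inner_toeplitz _ (memLp_wave a _),
    ← integral_mul_exp_fockMeasure h hd (z + I * ℏ * a) hi]
  refine integral_congr_ae ?_
  filter_upwards [coeFn_kernelVec h z, coeFn_ae_eq_entireRep u] with w h1 h2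
  rw [h1, h2, ← exp_conj, map_div₀, map_mul, conj_conj, conj_ofReal, wave, ← mul_assoc, ← mul_assoc,
    ← exp_add, ← exp_add]
  congr 2
  field_simp
  ring

/-- The weight of the second translation is evaluated at a point shifted by `iℏa`, while the weight
belonging to `a + b` also contains the cross term `iā · iℏb = -ℏāb`; the scalar compensates for it.
-/
theorem toeplitz_wave_comp (h : 0 < ℏ) (a b : ℂ) :
    toeplitz (fockSpace ℏ) (wave a) ∘L toeplitz (fockSpace ℏ) (wave b) =
      exp (ℏ * starRingEnd ℂ a * b) • toeplitz (fockSpace ℏ) (wave (a + b)) := by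
  refine ContinuousLinearMap.ext fun u => entireRep_injective ?_
  have hs : ∀ (c : ℂ) (v : fockSpace ℏ), entireRep (c • v) = c • entireRep v := fun c v =>
    funext fun z => by
      rw [Pi.smul_apply, ← inner_kernelVec h, ← inner_kernelVec h]
      exact inner_smul_right (kernelVec h z) v c
  funext z
  rw [ContinuousLinearMap.comp_apply, smul_apply, hs, Pi.smul_apply,
    smul_eq_mul, entireRep_toeplitz_wave h, entireRep_toeplitz_wave h, entireRep_toeplitz_wave h,
    ← mul_assoc, ← mul_assoc, ← exp_add, ← exp_add, map_add]
  have e : z + I * ℏ * a + I * ℏ * b = z + I * ℏ * (a + b) := by ring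
  rw [e]
  congr 2
  ring_nf
  simp only [I_sq]
  ring

theorem toeplitz_wave_zero :
    toeplitz (fockSpace ℏ) (wave 0) = ContinuousLinearMap.id ℂ (fockSpace ℏ) := by
  refine ContinuousLinearMap.ext fun u => ext_inner_left ℂ fun v => ?_
  rw [inner_toeplitz _ (memLp_wave 0 _), ContinuousLinearMap.id_apply, Submodule.coe_inner,
    L2.inner_def]
  simp [wave_zero, mul_comm]

/-- The adjoint has the conjugate symbol, and conjugating a plane wave negates its frequency. -/
theorem inner_toeplitz_wave_left (a : ℂ) (v u : fockSpace ℏ) :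
    inner ℂ (toeplitz (fockSpace ℏ) (wave a) v) u =
      inner ℂ v (toeplitz (fockSpace ℏ) (wave (-a)) u) := by
  refine (inner_conj_symm (𝕜 := ℂ) (toeplitz (fockSpace ℏ) (wave a) v) u).symm.trans ?_
  rw [inner_toeplitz _ (memLp_wave _ _), inner_toeplitz _ (memLp_wave _ _), ← integral_conj]
  congr 1 with z
  simp only [map_mul, conj_wave, conj_conj]
  ring

/-- By the composition rule `T_a* T_a = T_{-a} T_a = exp (-ℏ|a|²)`, so `T_a` is a scalar multiple of
an isometry. -/
theorem norm_toeplitz_wave_apply (h : 0 < ℏ) (a : ℂ) (u : fockSpace ℏ) :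
    ‖toeplitz (fockSpace ℏ) (wave a) u‖ = Real.exp (-ℏ * ‖a‖ ^ 2 / 2) * ‖u‖ := by
  have h1 : ((‖toeplitz (fockSpace ℏ) (wave a) u‖ ^ 2 : ℝ) : ℂ) =
      ((Real.exp (-ℏ * ‖a‖ ^ 2) * ‖u‖ ^ 2 : ℝ) : ℂ) := by
    have h2 := congrArg (fun T => T u) (toeplitz_wave_comp h (-a) a)
    simp only [ContinuousLinearMap.comp_apply, smul_apply, neg_add_cancel,
      toeplitz_wave_zero, ContinuousLinearMap.id_apply] at h2
    have h3 := inner_self_eq_norm_sq_to_K (𝕜 := ℂ) (toeplitz (fockSpace ℏ) (wave a) u)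
    rw [inner_toeplitz_wave_left, h2] at h3
    have h4 : inner ℂ u (exp (ℏ * starRingEnd ℂ (-a) * a) • u) =
        exp (ℏ * starRingEnd ℂ (-a) * a) * (‖u‖ : ℂ) ^ 2 :=
      (inner_smul_right _ _ _).trans (congrArg _ (inner_self_eq_norm_sq_to_K u))
    push_cast
    refine h3.symm.trans (h4.trans ?_)
    congr 2
    rw [map_neg, mul_neg, neg_mul, mul_assoc, ← normSq_eq_conj_mul_self, normSq_eq_norm_sq]
    push_cast
    ring
  have h4 : ‖toeplitz (fockSpace ℏ) (wave a) u‖ ^ 2 =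
      (Real.exp (-ℏ * ‖a‖ ^ 2 / 2) * ‖u‖) ^ 2 := by
    rw [ofReal_inj.1 h1, mul_pow, ← Real.exp_nat_mul]
    congr 2
    push_cast
    ring
  exact (sq_eq_sq₀ (norm_nonneg _) (by positivity)).1 h4

end PlaneWaves

/-! ### Superpositions of plane waves -/

section Superposition

open Complex

/-- The remainder of the exponential series, estimated by means of the real part. -/
theorem norm_exp_sub_sum_le_mul_max (n : ℕ) (x : ℂ) :
    ‖exp x - ∑ j ∈ Finset.range n, x ^ j / (j.factorial : ℂ)‖ ≤
      ‖x‖ ^ n * max 1 (Real.exp x.re) := by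
  induction n generalizing x with
  | zero => simp [norm_exp]
  | succ n ih =>
    -- Along the segment `t ↦ t x` the remainder of order `n + 1` vanishes at `t = 0` and has
    -- derivative `x` times the remainder of order `n`, so the mean value inequality drives the
    -- induction.
    have hder : ∀ t : ℝ, HasDerivAt (fun t : ℝ => exp (t * x) -
        ∑ j ∈ Finset.range (n + 1), (t * x) ^ j / (j.factorial : ℂ))
        (x * (exp (t * x) - ∑ j ∈ Finset.range n, (t * x) ^ j / (j.factorial : ℂ))) t := by
      intro t
      have hlin : HasDerivAt (fun t : ℝ => (t : ℂ) * x) x t := by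
        simpa using (ofRealCLM.hasDerivAt (x := t)).mul_const x
      have hsum : HasDerivAt (fun t : ℝ => ∑ j ∈ Finset.range (n + 1),
          ((t : ℂ) * x) ^ j / (j.factorial : ℂ)) (∑ j ∈ Finset.range (n + 1),
            ((j : ℂ) * (t * x) ^ (j - 1) * x) / (j.factorial : ℂ)) t :=
        HasDerivAt.fun_sum fun j _ => (hlin.pow j).div_const _
      refine (hlin.cexp.sub hsum).congr_deriv ?_
      rw [Finset.sum_range_succ']
      simp only [Nat.cast_zero, zero_mul, zero_div, add_zero, Nat.add_sub_cancel]
      rw [mul_sub, mul_comm x, Finset.mul_sum]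
      congr 1
      refine Finset.sum_congr rfl fun j _ => ?_
      have h1 : (j.factorial : ℂ) ≠ 0 := by exact_mod_cast j.factorial_ne_zero
      have h2 : ((j : ℂ) + 1) ≠ 0 := by exact_mod_cast j.succ_ne_zero
      rw [Nat.factorial_succ]
      push_cast
      field_simp
    have hbd := norm_image_sub_le_of_norm_deriv_le_segment_01'
      (C := ‖x‖ ^ (n + 1) * max 1 (Real.exp x.re))
      (fun t _ => (hder t).hasDerivWithinAt) (fun t ht => ?_)
    · simpa [Finset.sum_range_succ'] using hbd
    · rw [norm_mul, pow_succ', mul_assoc]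
      refine mul_le_mul_of_nonneg_left ((ih _).trans ?_) (norm_nonneg _)
      have h0 : ‖(t : ℂ) * x‖ ≤ ‖x‖ := by
        rw [norm_mul, norm_real, Real.norm_of_nonneg ht.1]
        exact mul_le_of_le_one_left (norm_nonneg _) ht.2.le
      -- The maximum with `1` makes the bound at `x` dominate the whole segment, whatever the sign
      -- of `Re x`.
      have h1 : max 1 (Real.exp ((t : ℂ) * x).re) ≤ max 1 (Real.exp x.re) := by
        rw [re_ofReal_mul]
        refine max_le (le_max_left _ _) ?_
        rcases le_total x.re 0 with hx | hx
        · exact le_max_of_le_left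
            (Real.exp_le_one_iff.2 (mul_nonpos_of_nonneg_of_nonpos ht.1 hx))
        · exact le_max_of_le_right
            (Real.exp_le_exp.2 (mul_le_of_le_one_left hx ht.2.le))
      gcongr

variable {Ω Ω' : Type*} [MeasurableSpace Ω] [MeasurableSpace Ω'] {m : Measure Ω} {m' : Measure Ω'}

/-- The superposition `∫ c(ω) exp (i (a(ω) z̄ + conj a(ω) z)) dm(ω)` of plane waves. -/
noncomputable def waveIntegral (m : Measure Ω) (c a : Ω → ℂ) (z : ℂ) : ℂ :=
  ∫ ω, c ω * wave (a ω) z ∂m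

theorem aestronglyMeasurable_mul_wave {c a : Ω → ℂ} (hc : AEStronglyMeasurable c m)
    (ha : Measurable a) (z : ℂ) : AEStronglyMeasurable (fun ω => c ω * wave (a ω) z) m :=
  hc.mul ((continuous_wave.measurable.comp (ha.prodMk measurable_const)).aestronglyMeasurable)

theorem continuous_waveIntegral {c a : Ω → ℂ} (hc : Integrable c m) (ha : Measurable a) :
    Continuous (waveIntegral m c a) := by
  refine continuous_of_dominated (bound := fun ω => ‖c ω‖)
    (fun z => aestronglyMeasurable_mul_wave hc.1 ha z)
    (fun z => .of_forall fun ω => by simp [norm_wave]) hc.norm (.of_forall fun ω => ?_)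
  exact continuous_const.mul (continuous_wave.comp (Continuous.prodMk_right _))

theorem norm_waveIntegral_le (c a : Ω → ℂ) (z : ℂ) :
    ‖waveIntegral m c a z‖ ≤ ∫ ω, ‖c ω‖ ∂m := by
  refine (norm_integral_le_integral_norm _).trans (le_of_eq ?_)
  simp [norm_wave]

theorem memLp_waveIntegral {c a : Ω → ℂ} (hc : Integrable c m) (ha : Measurable a)
    (ν : Measure ℂ) : MemLp (waveIntegral m c a) ⊤ ν :=
  memLp_top_of_bound (continuous_waveIntegral hc ha).aestronglyMeasurable _
    (.of_forall fun z => norm_waveIntegral_le c a z)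

theorem waveIntegral_mul_waveIntegral [SFinite m] [SFinite m'] (c a : Ω → ℂ) (d b : Ω' → ℂ)
    (z : ℂ) :
    waveIntegral m c a z * waveIntegral m' d b z =
      waveIntegral (m.prod m') (fun p => c p.1 * d p.2) (fun p => a p.1 + b p.2) z := by
  rw [waveIntegral, waveIntegral, waveIntegral, ← integral_prod_mul]
  congr 1 with p
  rw [wave_add]
  ring

/-- This is `|a + b|² - 2 Re (ā b) = |a|² + |b|² ≥ 0`. -/
theorem re_mul_conj_sub_le {ℏ : ℝ} (a b : ℂ) (h : 0 < ℏ) :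
    (ℏ * starRingEnd ℂ a * b).re + -ℏ * ‖a + b‖ ^ 2 / 2 ≤ 0 := by
  rw [← normSq_eq_norm_sq, mul_assoc, re_ofReal_mul]
  simp only [normSq_apply, mul_re, add_re, add_im, conj_re, conj_im]
  nlinarith [mul_nonneg h.le (add_nonneg (add_nonneg (sq_nonneg a.re) (sq_nonneg a.im))
    (add_nonneg (sq_nonneg b.re) (sq_nonneg b.im)))]

variable {ℏ : ℝ} [CompleteSpace (fockSpace ℏ)]

/-- Fubini, with plane waves of modulus one: the Toeplitz operator is the weak integral of those of
the waves, which is all that is needed in place of an operator-valued integral. -/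
theorem inner_toeplitz_waveIntegral [SFinite m] (h : 0 < ℏ) {c a : Ω → ℂ} (hc : Integrable c m)
    (ha : Measurable a) (v u : fockSpace ℏ) :
    inner ℂ v (toeplitz (fockSpace ℏ) (waveIntegral m c a) u) =
      ∫ ω, c ω * inner ℂ v (toeplitz (fockSpace ℏ) (wave (a ω)) u) ∂m := by
  have := isProbabilityMeasure_fockMeasure h
  set φ : ℂ → ℂ := fun z =>
    starRingEnd ℂ ((v : Lp ℂ 2 (fockMeasure ℏ)) z) * (u : Lp ℂ 2 (fockMeasure ℏ)) z with hφ
  have hφi : Integrable φ (fockMeasure ℏ) := by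
    simpa [wave_zero] using integrable_conj_mul_mul (memLp_wave 0 (fockMeasure ℏ))
      (v : Lp ℂ 2 (fockMeasure ℏ)) (u : Lp ℂ 2 (fockMeasure ℏ))
  have hint : Integrable (fun p : ℂ × Ω => wave (a p.2) p.1 * (φ p.1 * c p.2))
      ((fockMeasure ℏ).prod m) := by
    refine (hφi.mul_prod hc).bdd_mul ?_ (.of_forall fun p => (norm_wave _ _).le)
    exact (continuous_wave.measurable.comp
      ((ha.comp measurable_snd).prodMk measurable_fst)).aestronglyMeasurable
  have hswap := integral_integral_swap (f := fun z ω => wave (a ω) z * (φ z * c ω)) hint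
  rw [inner_toeplitz _ (memLp_waveIntegral hc ha _)]
  refine Eq.trans ?_ (hswap.trans ?_)
  · congr 1 with z
    rw [waveIntegral, mul_left_comm, ← integral_mul_const]
    congr 1 with ω
    ring
  · congr 1 with ω
    rw [inner_toeplitz _ (memLp_wave _ _), ← integral_const_mul]
    congr 1 with z
    simp only [hφ]
    ring

theorem norm_inner_toeplitz_wave_le (h : 0 < ℏ) (a : ℂ) (v u : fockSpace ℏ) :
    ‖inner ℂ v (toeplitz (fockSpace ℏ) (wave a) u)‖ ≤
      Real.exp (-ℏ * ‖a‖ ^ 2 / 2) * (‖v‖ * ‖u‖) := by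
  refine (norm_inner_le_norm (𝕜 := ℂ) v _).trans (le_of_eq ?_)
  rw [norm_toeplitz_wave_apply h]
  ring

theorem continuous_inner_toeplitz_wave (v u : fockSpace ℏ) :
    Continuous fun a => inner ℂ v (toeplitz (fockSpace ℏ) (wave a) u) := by
  simp only [fun a => inner_toeplitz (fockSpace ℏ) (memLp_wave a _) v u]
  refine continuous_of_dominated
    (bound := fun z => ‖starRingEnd ℂ ((v : Lp ℂ 2 (fockMeasure ℏ)) z) *
      (wave 0 z * (u : Lp ℂ 2 (fockMeasure ℏ)) z)‖)
    (fun a => (integrable_conj_mul_mul (memLp_wave a _) _ _).1)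
    (fun a => .of_forall fun z => by simp [norm_wave])
    (integrable_conj_mul_mul (memLp_wave 0 _) _ _).norm (.of_forall fun z => ?_)
  exact continuous_const.mul
    ((continuous_wave.comp (Continuous.prodMk_left z)).mul continuous_const)

/-- The decay `exp (-ℏ|a+b|²/2)` of the Toeplitz operator beats the growth of the composition
factor, with no loss in `a`, `b` or `ℏ`. Without it the remainder would need Gaussian decay of the
amplitudes. -/
theorem max_exp_mul_norm_inner_toeplitz_wave_le (h : 0 < ℏ) (a b : ℂ) (v u : fockSpace ℏ) :
    max 1 (Real.exp (ℏ * starRingEnd ℂ a * b).re) *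
      ‖inner ℂ v (toeplitz (fockSpace ℏ) (wave (a + b)) u)‖ ≤ ‖v‖ * ‖u‖ := by
  refine (mul_le_mul_of_nonneg_left (norm_inner_toeplitz_wave_le h _ v u) (by positivity)).trans ?_
  rw [← mul_assoc]
  refine mul_le_of_le_one_left (by positivity) ?_
  rw [max_mul_of_nonneg _ _ (Real.exp_nonneg _), one_mul, ← Real.exp_add]
  refine max_le (Real.exp_le_one_iff.2 ?_) (Real.exp_le_one_iff.2 (re_mul_conj_sub_le a b h))
  have : 0 ≤ ℏ * ‖a + b‖ ^ 2 := by positivity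
  linarith

theorem integrable_exp_mul_inner_toeplitz_wave [SFinite m] [SFinite m'] (h : 0 < ℏ)
    {c a : Ω → ℂ} (hc : Integrable c m) (ha : Measurable a) {d b : Ω' → ℂ} (hd : Integrable d m')
    (hb : Measurable b) (v u : fockSpace ℏ) :
    Integrable (fun p : Ω × Ω' => (exp (ℏ * starRingEnd ℂ (a p.1) * b p.2) *
      inner ℂ v (toeplitz (fockSpace ℏ) (wave (a p.1 + b p.2)) u)) * (c p.1 * d p.2))
      (m.prod m') := by
  have hab : Measurable fun p : Ω × Ω' => (a p.1, b p.2) :=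
    (ha.comp measurable_fst).prodMk (hb.comp measurable_snd)
  refine (hc.mul_prod hd).bdd_mul (c := ‖v‖ * ‖u‖) ?_ (.of_forall fun p => ?_)
  · refine Measurable.aestronglyMeasurable ?_
    have hcont : Continuous fun q : ℂ × ℂ => exp (ℏ * starRingEnd ℂ q.1 * q.2) *
        inner ℂ v (toeplitz (fockSpace ℏ) (wave (q.1 + q.2)) u) :=
      Continuous.mul (by fun_prop)
        ((continuous_inner_toeplitz_wave v u).comp (continuous_fst.add continuous_snd))
    have hm := hcont.measurable.comp hab
    exact hm
  · rw [norm_mul, norm_exp]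
    exact (mul_le_mul_of_nonneg_right (le_max_right _ _) (norm_nonneg _)).trans
      (max_exp_mul_norm_inner_toeplitz_wave_le h _ _ v u)

theorem inner_toeplitz_waveIntegral_comp [SFinite m] [SFinite m'] (h : 0 < ℏ)
    {c a : Ω → ℂ} (hc : Integrable c m) (ha : Measurable a) {d b : Ω' → ℂ} (hd : Integrable d m')
    (hb : Measurable b) (v u : fockSpace ℏ) :
    inner ℂ v (toeplitz (fockSpace ℏ) (waveIntegral m c a)
      (toeplitz (fockSpace ℏ) (waveIntegral m' d b) u)) =
      ∫ p, (exp (ℏ * starRingEnd ℂ (a p.1) * b p.2) *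
        inner ℂ v (toeplitz (fockSpace ℏ) (wave (a p.1 + b p.2)) u)) * (c p.1 * d p.2)
        ∂m.prod m' := by
  rw [integral_prod _ (integrable_exp_mul_inner_toeplitz_wave h hc ha hd hb v u),
    inner_toeplitz_waveIntegral h hc ha]
  congr 1 with ω
  -- The left plane wave operator is moved to `v`, so that the weak integral formula also applies to
  -- the inner factor; it is moved back once both integrals are outside.
  have e1 := inner_toeplitz_wave_left (-a ω) v
    (toeplitz (fockSpace ℏ) (waveIntegral m' d b) u)
  rw [neg_neg] at e1
  rw [← e1, inner_toeplitz_waveIntegral h hd hb, ← integral_const_mul]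
  congr 1 with ω'
  have e2 := congrArg (fun T => T u) (toeplitz_wave_comp h (a ω) (b ω'))
  simp only [ContinuousLinearMap.comp_apply, smul_apply] at e2
  have e3 := inner_smul_right v (toeplitz (fockSpace ℏ) (wave (a ω + b ω')) u)
    (exp (ℏ * starRingEnd ℂ (a ω) * b ω'))
  rw [inner_toeplitz_wave_left, neg_neg, e2]
  refine Eq.trans (congrArg _ (congrArg _ e3)) ?_
  ring

/-- The remainder of the star product expansion of two superpositions of plane waves. -/
theorem norm_toeplitz_waveIntegral_comp_sub_sum_le [SFinite m] [SFinite m'] (h : 0 < ℏ)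
    {c a : Ω → ℂ} (hc : AEStronglyMeasurable c m) (ha : Measurable a)
    (hca : ∀ k, Integrable (fun ω => ‖a ω‖ ^ k * ‖c ω‖) m)
    {d b : Ω' → ℂ} (hd : AEStronglyMeasurable d m') (hb : Measurable b)
    (hdb : ∀ k, Integrable (fun ω => ‖b ω‖ ^ k * ‖d ω‖) m') (N : ℕ) :
    ‖toeplitz (fockSpace ℏ) (waveIntegral m c a) ∘L
        toeplitz (fockSpace ℏ) (waveIntegral m' d b) -
      ∑ j ∈ Finset.range (N + 1), (ℏ : ℂ) ^ j • toeplitz (fockSpace ℏ) (fun z =>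
        (-1) ^ j / (j.factorial : ℂ) *
          waveIntegral m (fun ω => (I * starRingEnd ℂ (a ω)) ^ j * c ω) a z *
          waveIntegral m' (fun ω => (I * b ω) ^ j * d ω) b z)‖ ≤
      (∫ ω, ‖a ω‖ ^ (N + 1) * ‖c ω‖ ∂m) * (∫ ω, ‖b ω‖ ^ (N + 1) * ‖d ω‖ ∂m') *
        ℏ ^ (N + 1) := by
  have hconj : Measurable fun ω => starRingEnd ℂ (a ω) := continuous_conj.measurable.comp ha
  have hcj : ∀ j, Integrable (fun ω => (I * starRingEnd ℂ (a ω)) ^ j * c ω) m := fun j =>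
    (hca j).mono' (((measurable_const.mul hconj).pow_const j).aestronglyMeasurable.mul hc)
      (.of_forall fun ω => by simp)
  have hdj : ∀ j, Integrable (fun ω => (I * b ω) ^ j * d ω) m' := fun j =>
    (hdb j).mono' (((measurable_const.mul hb).pow_const j).aestronglyMeasurable.mul hd)
      (.of_forall fun ω => by simp)
  have hc0 : Integrable c m := by simpa using hcj 0
  have hd0 : Integrable d m' := by simpa using hdj 0
  have hab : Measurable fun p : Ω × Ω' => a p.1 + b p.2 :=
    (ha.comp measurable_fst).add (hb.comp measurable_snd)
  -- Each term is again a superposition over the product space with frequencies `a + b`, so every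
  -- term involves the same operators `T_{a+b}` as the composition and the difference becomes one
  -- integral.
  have hterm : ∀ j, (fun z => (-1) ^ j / (j.factorial : ℂ) *
      waveIntegral m (fun ω => (I * starRingEnd ℂ (a ω)) ^ j * c ω) a z *
      waveIntegral m' (fun ω => (I * b ω) ^ j * d ω) b z) =
      waveIntegral (m.prod m') (fun p => ((-1) ^ j / (j.factorial : ℂ)) *
        (((I * starRingEnd ℂ (a p.1)) ^ j * c p.1) * ((I * b p.2) ^ j * d p.2)))
        (fun p => a p.1 + b p.2) := fun j => by
    funext z
    rw [mul_assoc, waveIntegral_mul_waveIntegral, waveIntegral, waveIntegral, ← integral_const_mul]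
    congr 1 with p
    ring
  have htermi : ∀ j, Integrable (fun p : Ω × Ω' => ((-1) ^ j / (j.factorial : ℂ)) *
      (((I * starRingEnd ℂ (a p.1)) ^ j * c p.1) * ((I * b p.2) ^ j * d p.2))) (m.prod m') :=
    fun j => ((hcj j).mul_prod (hdj j)).const_mul _
  have hA : Integrable (fun p : Ω × Ω' => (‖a p.1‖ ^ (N + 1) * ‖c p.1‖) *
      (‖b p.2‖ ^ (N + 1) * ‖d p.2‖)) (m.prod m') := (hca _).mul_prod (hdb _)
  have hbound : ∀ v u : fockSpace ℏ, ‖inner ℂ v ((toeplitz (fockSpace ℏ) (waveIntegral m c a) ∘L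
        toeplitz (fockSpace ℏ) (waveIntegral m' d b) -
      ∑ j ∈ Finset.range (N + 1), (ℏ : ℂ) ^ j • toeplitz (fockSpace ℏ) (fun z =>
        (-1) ^ j / (j.factorial : ℂ) *
          waveIntegral m (fun ω => (I * starRingEnd ℂ (a ω)) ^ j * c ω) a z *
          waveIntegral m' (fun ω => (I * b ω) ^ j * d ω) b z)) u)‖ ≤
      (∫ ω, ‖a ω‖ ^ (N + 1) * ‖c ω‖ ∂m) * (∫ ω, ‖b ω‖ ^ (N + 1) * ‖d ω‖ ∂m') *
        ℏ ^ (N + 1) * (‖v‖ * ‖u‖) := by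
    intro v u
    have hM : ∀ p : Ω × Ω', ‖inner ℂ v (toeplitz (fockSpace ℏ) (wave (a p.1 + b p.2)) u)‖ ≤
        ‖v‖ * ‖u‖ := fun p =>
      (le_mul_of_one_le_left (norm_nonneg _) (le_max_left _ _)).trans
        (max_exp_mul_norm_inner_toeplitz_wave_le h (a p.1) (b p.2) v u)
    have hji : ∀ j, Integrable (fun p : Ω × Ω' => (ℏ : ℂ) ^ j * ((((-1) ^ j / (j.factorial : ℂ)) *
        (((I * starRingEnd ℂ (a p.1)) ^ j * c p.1) * ((I * b p.2) ^ j * d p.2))) *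
        inner ℂ v (toeplitz (fockSpace ℏ) (wave (a p.1 + b p.2)) u))) (m.prod m') := by
      intro j
      refine Integrable.const_mul ?_ _
      refine (htermi j).mul_bdd ?_ (.of_forall hM)
      exact ((continuous_inner_toeplitz_wave v u).measurable.comp hab).aestronglyMeasurable
    have e : inner ℂ v ((toeplitz (fockSpace ℏ) (waveIntegral m c a) ∘L
        toeplitz (fockSpace ℏ) (waveIntegral m' d b) -
      ∑ j ∈ Finset.range (N + 1), (ℏ : ℂ) ^ j • toeplitz (fockSpace ℏ) (fun z =>
        (-1) ^ j / (j.factorial : ℂ) *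
          waveIntegral m (fun ω => (I * starRingEnd ℂ (a ω)) ^ j * c ω) a z *
          waveIntegral m' (fun ω => (I * b ω) ^ j * d ω) b z)) u) =
        ∫ p, (exp (ℏ * starRingEnd ℂ (a p.1) * b p.2) - ∑ j ∈ Finset.range (N + 1),
          (ℏ * starRingEnd ℂ (a p.1) * b p.2) ^ j / (j.factorial : ℂ)) *
          inner ℂ v (toeplitz (fockSpace ℏ) (wave (a p.1 + b p.2)) u) * (c p.1 * d p.2)
          ∂m.prod m' := by
      simp only [hterm, sub_apply, ContinuousLinearMap.comp_apply, sum_apply,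
        smul_apply]
      refine (inner_sub_right (𝕜 := ℂ) v _ _).trans ?_
      rw [inner_toeplitz_waveIntegral_comp h hc0 ha hd0 hb]
      refine (congrArg _ (inner_sum (𝕜 := ℂ) (Finset.range (N + 1)) _ v)).trans ?_
      have e1 : ∀ j ∈ Finset.range (N + 1), inner ℂ v ((ℏ : ℂ) ^ j • toeplitz (fockSpace ℏ)
          (waveIntegral (m.prod m') (fun p => ((-1) ^ j / (j.factorial : ℂ)) *
            (((I * starRingEnd ℂ (a p.1)) ^ j * c p.1) * ((I * b p.2) ^ j * d p.2)))
          (fun p => a p.1 + b p.2)) u) = ∫ p : Ω × Ω', (ℏ : ℂ) ^ j *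
          ((((-1) ^ j / (j.factorial : ℂ)) *
          (((I * starRingEnd ℂ (a p.1)) ^ j * c p.1) * ((I * b p.2) ^ j * d p.2))) *
          inner ℂ v (toeplitz (fockSpace ℏ) (wave (a p.1 + b p.2)) u)) ∂m.prod m' := by
        intro j _
        refine (inner_smul_right v _ _).trans ?_
        rw [inner_toeplitz_waveIntegral h (htermi j) hab, ← integral_const_mul]
      rw [Finset.sum_congr rfl e1, ← integral_finsetSum _ (fun j _ => hji j), ← integral_sub
        (integrable_exp_mul_inner_toeplitz_wave h hc0 ha hd0 hb v u)
        (integrable_finsetSum _ fun j _ => hji j)]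
      congr 1 with p
      rw [sub_mul, sub_mul, Finset.sum_mul, Finset.sum_mul]
      congr 1
      refine Finset.sum_congr rfl fun j _ => ?_
      -- The sign `(-1)^j` from the two factors `I^j` of the derivatives cancels the sign in the
      -- star coefficient, leaving the Taylor term of `exp (ℏ ā b)`.
      have hI : (I * starRingEnd ℂ (a p.1)) ^ j * (I * b p.2) ^ j =
          (-1) ^ j * (starRingEnd ℂ (a p.1) * b p.2) ^ j := by
        rw [← mul_pow, ← mul_pow]
        congr 1
        linear_combination (starRingEnd ℂ (a p.1) * b p.2) * I_mul_I
      have h1 : ((-1 : ℂ)) ^ j * (-1) ^ j = 1 := by rw [← mul_pow]; simp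
      rw [mul_assoc (ℏ : ℂ), mul_pow (ℏ : ℂ)]
      linear_combination ((ℏ : ℂ) ^ j * ((-1) ^ j / (j.factorial : ℂ)) * (c p.1 * d p.2) *
          inner ℂ v (toeplitz (fockSpace ℏ) (wave (a p.1 + b p.2)) u)) * hI +
        ((ℏ : ℂ) ^ j / (j.factorial : ℂ) * (starRingEnd ℂ (a p.1) * b p.2) ^ j *
          (c p.1 * d p.2) *
          inner ℂ v (toeplitz (fockSpace ℏ) (wave (a p.1 + b p.2)) u)) * h1
    rw [e, ← integral_prod_mul, mul_assoc, ← integral_mul_const]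
    refine norm_integral_le_of_norm_le (hA.mul_const _) (.of_forall fun p => ?_)
    rw [norm_mul, norm_mul, norm_mul]
    have h1 := norm_exp_sub_sum_le_mul_max (N + 1) (ℏ * starRingEnd ℂ (a p.1) * b p.2)
    have h2 := max_exp_mul_norm_inner_toeplitz_wave_le h (a p.1) (b p.2) v u
    have h3 : ‖(ℏ * starRingEnd ℂ (a p.1) * b p.2)‖ = ℏ * ‖a p.1‖ * ‖b p.2‖ := by
      rw [norm_mul, norm_mul, norm_real, Real.norm_of_nonneg h.le, norm_conj]
    rw [h3] at h1
    calc _ ≤ ((ℏ * ‖a p.1‖ * ‖b p.2‖) ^ (N + 1) *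
            max 1 (Real.exp (ℏ * starRingEnd ℂ (a p.1) * b p.2).re)) *
          ‖inner ℂ v (toeplitz (fockSpace ℏ) (wave (a p.1 + b p.2)) u)‖ *
          (‖c p.1‖ * ‖d p.2‖) := by gcongr
      _ = (ℏ * ‖a p.1‖ * ‖b p.2‖) ^ (N + 1) *
          (max 1 (Real.exp (ℏ * starRingEnd ℂ (a p.1) * b p.2).re) *
          ‖inner ℂ v (toeplitz (fockSpace ℏ) (wave (a p.1 + b p.2)) u)‖) *
          (‖c p.1‖ * ‖d p.2‖) := by ring
      _ ≤ (ℏ * ‖a p.1‖ * ‖b p.2‖) ^ (N + 1) * (‖v‖ * ‖u‖) * (‖c p.1‖ * ‖d p.2‖) := by gcongr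
      _ = _ := by ring
  refine ContinuousLinearMap.opNorm_le_of_re_inner_le (𝕜 := ℂ) (by positivity)
    fun u v hu hv => ?_
  refine (RCLike.re_le_norm _).trans ?_
  refine (norm_inner_symm _ _).trans_le ?_
  refine (hbound v u).trans_eq ?_
  rw [hu, hv, mul_one, mul_one]

end Superposition

/-! ### Coordinates on the phase space, averaging and the transform. -/

namespace Params

open Complex

variable (P : Params)

/-! ### The chart `(z, y) ↦ x` with `z = z^NC(x)` -/

theorem sqrt_half : √(P.ℏ / 2) = √(2 * P.ℏ) / 2 := by
  rw [show P.ℏ / 2 = 2 * P.ℏ / 2 ^ 2 by ring, Real.sqrt_div (by linarith [P.ℏ_pos]),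
    Real.sqrt_sq (by norm_num)]

theorem sqrt_two_mul_pos : 0 < √(2 * P.ℏ) := Real.sqrt_pos.2 (by linarith [P.ℏ_pos])

/-- The point of the phase space with `z^NC = w.1` and `(q₂, p₂) = w.2`. -/
noncomputable def chart (w : ℂ × (ℝ × ℝ)) : Phase :=
  ((P.s / √(2 * P.ℏ) * (2 * w.1.re) + P.ϑ / P.ℏ * w.2.2,
    √(P.ℏ / 2) / P.s * (-2 * w.1.im) - P.ℏ / P.ϑ * w.2.1 - 2 * P.κ * P.ℏ), w.2)

theorem qNC_chart (w : ℂ × (ℝ × ℝ)) : P.qNC (P.chart w) = P.s / √(2 * P.ℏ) * (2 * w.1.re) := by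
  simp [qNC, chart]

theorem pNC_chart (w : ℂ × (ℝ × ℝ)) :
    P.pNC (P.chart w) = √(P.ℏ / 2) / P.s * (-2 * w.1.im) := by
  simp only [pNC, chart]
  ring

theorem zNC_re (x : Phase) : (P.zNC x).re = √(P.ℏ / 2) * P.qNC x / P.s := by
  simp only [zNC, sub_re, mul_re, I_re, I_im, ofReal_re, ofReal_im]
  ring

theorem zNC_im (x : Phase) : (P.zNC x).im = -(P.s * P.pNC x / √(2 * P.ℏ)) := by
  simp only [zNC, sub_im, mul_im, I_re, I_im, ofReal_re, ofReal_im]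
  ring

theorem zNC_chart (w : ℂ × (ℝ × ℝ)) : P.zNC (P.chart w) = w.1 := by
  have h1 := P.sqrt_two_mul_pos.ne'
  have h2 := P.s_pos.ne'
  apply Complex.ext
  · rw [zNC_re, qNC_chart, sqrt_half]
    field_simp
  · rw [zNC_im, pNC_chart, sqrt_half]
    field_simp

theorem chart_zNC (x : Phase) : P.chart (P.zNC x, x.2) = x := by
  have h1 := P.sqrt_two_mul_pos.ne'
  have h2 := P.s_pos.ne'
  refine Prod.ext (Prod.ext ?_ ?_) rfl
  · simp only [chart, zNC_re, qNC, sqrt_half]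
    field_simp
    ring
  · simp only [chart, zNC_im, pNC, sqrt_half]
    field_simp
    ring

theorem continuous_zNC : Continuous P.zNC := by
  unfold zNC qNC pNC
  fun_prop

theorem continuous_chart : Continuous P.chart := by
  unfold chart
  fun_prop

/-- The chart as a homeomorphism. -/
noncomputable def chartHomeomorph : ℂ × (ℝ × ℝ) ≃ₜ Phase where
  toFun := P.chart
  invFun x := (P.zNC x, x.2)
  left_inv w := Prod.ext (P.zNC_chart w) rfl
  right_inv x := P.chart_zNC x
  continuous_toFun := P.continuous_chart
  continuous_invFun := P.continuous_zNC.prodMk continuous_snd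

theorem zNC_surjective : Function.Surjective P.zNC := fun z => ⟨P.chart (z, 0), P.zNC_chart _⟩

/-- The Lebesgue measure `(π ℏ)⁻¹ dA` on `ℂ`. -/
noncomputable def planeMeasure : Measure ℂ := ENNReal.ofReal (1 / (Real.pi * P.ℏ)) • volume

instance : SFinite P.planeMeasure := by unfold planeMeasure; infer_instance

theorem ae_planeMeasure : ae P.planeMeasure = ae volume := by
  refine Measure.ae_ennreal_smul_measure_eq ?_ _
  have := P.ℏ_pos
  have : 0 < 1 / (Real.pi * P.ℏ) := by positivity
  simpa only [ne_eq, ENNReal.ofReal_eq_zero, not_le] using this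

theorem map_affine_volume {c₁ c₂ : ℝ} (h₁ : c₁ ≠ 0) (h₂ : c₂ ≠ 0) (d₁ d₂ : ℝ) :
    Measure.map (fun z : ℂ => (c₁ * z.re + d₁, c₂ * z.im + d₂)) volume =
      ENNReal.ofReal |(c₁ * c₂)⁻¹| • (volume : Measure (ℝ × ℝ)) := by
  have key : ∀ {c : ℝ}, c ≠ 0 → ∀ d : ℝ, Measure.map (fun x : ℝ => c * x + d) volume =
      ENNReal.ofReal |c⁻¹| • volume := by
    intro c hc d
    have h := Measure.map_map (μ := (volume : Measure ℝ)) (measurable_add_const d)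
      (measurable_const_mul c)
    rw [Real.map_volume_mul_left hc, Measure.map_smul, map_add_right_eq_self] at h
    exact h.symm
  have hf : (fun z : ℂ => (c₁ * z.re + d₁, c₂ * z.im + d₂)) =
      Prod.map (fun x => c₁ * x + d₁) (fun x => c₂ * x + d₂) ∘ measurableEquivRealProd := by
    funext z
    simp [measurableEquivRealProd_apply]
  rw [hf, ← Measure.map_map (by fun_prop) measurableEquivRealProd.measurable,
    volume_preserving_equiv_real_prod.map_eq, Measure.volume_eq_prod,
    ← Measure.map_prod_map _ _ (by fun_prop) (by fun_prop), key h₁, key h₂,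
    Measure.prod_smul_left, Measure.prod_smul_right, smul_smul, ← ENNReal.ofReal_mul (abs_nonneg _),
    ← abs_mul, mul_inv]

/-- For fixed `y` the chart is affine in `z` with determinant `-2` for every `s`, which turns
`1/(πℏ)` into `1/(2πℏ)`; the `y`-dependent translations do not affect Lebesgue measure, so the map
is a skew product. -/
theorem measurePreserving_chart (μ : Measure (ℝ × ℝ)) [SFinite μ] :
    MeasurePreserving P.chart (P.planeMeasure.prod μ) (P.nu μ) := by
  have hs := P.s_pos
  have ht := P.sqrt_two_mul_pos
  have hℏ := P.ℏ_pos
  have hfib : ∀ y : ℝ × ℝ, Measure.map (fun z : ℂ => (P.chart (z, y)).1) P.planeMeasure =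
      ENNReal.ofReal (1 / (2 * Real.pi * P.ℏ)) • (volume : Measure (ℝ × ℝ)) := by
    intro y
    have h := map_affine_volume (c₁ := P.s / √(2 * P.ℏ) * 2) (c₂ := √(P.ℏ / 2) / P.s * -2)
      (by positivity) (by rw [sqrt_half]; exact mul_ne_zero (by positivity) (by norm_num))
      (P.ϑ / P.ℏ * y.2) (-(P.ℏ / P.ϑ * y.1) - 2 * P.κ * P.ℏ)
    have hc : P.s / √(2 * P.ℏ) * 2 * (√(P.ℏ / 2) / P.s * -2) = -2 := by
      rw [sqrt_half]
      field_simp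
    have hfun : (fun z : ℂ => (P.chart (z, y)).1) = fun z : ℂ =>
        (P.s / √(2 * P.ℏ) * 2 * z.re + P.ϑ / P.ℏ * y.2,
          √(P.ℏ / 2) / P.s * -2 * z.im + (-(P.ℏ / P.ϑ * y.1) - 2 * P.κ * P.ℏ)) := by
      funext z
      simp only [chart]
      refine Prod.ext ?_ ?_ <;> simp only <;> ring
    rw [planeMeasure, Measure.map_smul, hfun, h, hc, smul_smul,
      ← ENNReal.ofReal_mul (by positivity)]
    congr 2
    norm_num
    ring
  have hsk := (MeasurePreserving.id μ).skew_product (μc := P.planeMeasure)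
    (g := fun y z => (P.chart (z, y)).1)
    (by
      have := P.continuous_chart
      exact (Continuous.fst (this.comp continuous_swap)).measurable)
    (.of_forall hfib)
  have h1 : MeasurePreserving Prod.swap (P.planeMeasure.prod μ) (μ.prod P.planeMeasure) :=
    ⟨measurable_swap, Measure.prod_swap⟩
  have h2 : MeasurePreserving Prod.swap
      (μ.prod (ENNReal.ofReal (1 / (2 * Real.pi * P.ℏ)) • (volume : Measure (ℝ × ℝ))))
      (P.nu μ) := by
    refine ⟨measurable_swap, ?_⟩
    rw [Measure.prod_swap, Measure.prod_smul_left, nu]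
  exact (h2.comp hsk).comp h1

theorem measurePreserving_zNC (μ : Measure (ℝ × ℝ)) [IsProbabilityMeasure μ] :
    MeasurePreserving P.zNC (P.nu μ) P.planeMeasure := by
  refine ⟨P.continuous_zNC.measurable, ?_⟩
  rw [← (P.measurePreserving_chart μ).map_eq,
    Measure.map_map P.continuous_zNC.measurable P.continuous_chart.measurable]
  have : P.zNC ∘ P.chart = Prod.fst := funext P.zNC_chart
  rw [this]
  exact measurePreserving_fst.map_eq

/-! ### The averaging map `ϱ` on bounded functions -/

theorem rho_apply (μ : Measure (ℝ × ℝ)) (F : Phase → ℂ) (z : ℂ) :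
    P.rho μ F z = ∫ y, F (P.chart (z, y)) ∂μ := rfl

theorem memLp_rho (μ : Measure (ℝ × ℝ)) [IsProbabilityMeasure μ] {F : Phase → ℂ}
    (hF : MemLp F ⊤ (P.nu μ)) : MemLp (P.rho μ F) ⊤ (volume : Measure ℂ) := by
  have hF' : MemLp (F ∘ P.chart) ⊤ (P.planeMeasure.prod μ) :=
    hF.comp_measurePreserving (P.measurePreserving_chart μ)
  obtain ⟨C, hC⟩ : ∃ C : ℝ, ∀ᵐ w ∂P.planeMeasure.prod μ, ‖F (P.chart w)‖ ≤ C := by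
    refine ⟨(eLpNorm (F ∘ P.chart) ⊤ (P.planeMeasure.prod μ)).toReal, ?_⟩
    have h1 := ae_le_eLpNormEssSup (f := F ∘ P.chart) (μ := P.planeMeasure.prod μ)
    rw [← eLpNorm_exponent_top] at h1
    filter_upwards [h1] with w hw
    have := ENNReal.toReal_mono hF'.2.ne hw
    simpa using this
  have hm : AEStronglyMeasurable (P.rho μ F) P.planeMeasure :=
    AEStronglyMeasurable.integral_prod_right' hF'.1
  have hm' : AEStronglyMeasurable (P.rho μ F) volume :=
    hm.mono_ac (Measure.ae_le_iff_absolutelyContinuous.1 P.ae_planeMeasure.ge)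
  refine memLp_top_of_bound hm' C ?_
  rw [← P.ae_planeMeasure]
  filter_upwards [Measure.ae_ae_of_ae_prod hC] with z hz
  rw [rho_apply]
  refine (norm_integral_le_of_norm_le_const hz).trans ?_
  simp

/-- The function `z^NC` is constant on the fibres over which `ϱ` averages, and `μ` has mass one. -/
theorem isRightInverse_rhoStar (μ : Measure (ℝ × ℝ)) [IsProbabilityMeasure μ] :
    P.IsRightInverse μ P.rhoStar := by
  intro f hf
  refine ⟨?_, .of_forall fun z => ?_⟩
  · have h1 : MemLp f ⊤ P.planeMeasure := hf.smul_measure ENNReal.ofReal_ne_top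
    exact h1.comp_measurePreserving (P.measurePreserving_zNC μ)
  · simp [rho_apply, rhoStar, zNC_chart]

/-! ### The transform -/

/-- The factor by which the transform multiplies the pullback along `z^NC`. -/
noncomputable def weight (x : Phase) : ℂ :=
  exp (I * ((P.δ * x.2.1 + P.κ * P.ϑ * x.2.2 / P.ℏ : ℝ) : ℂ)) *
    (Real.exp (-‖P.zNC x‖ ^ 2 / (2 * P.ℏ)) : ℂ)

theorem transform_apply (g : ℂ → ℂ) (x : Phase) :
    P.transform g x = P.weight x * g (P.zNC x) := rfl

theorem norm_weight (x : Phase) : ‖P.weight x‖ = Real.exp (-‖P.zNC x‖ ^ 2 / (2 * P.ℏ)) := by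
  rw [weight, norm_mul, mul_comm I, norm_exp_ofReal_mul_I, one_mul, norm_real,
    Real.norm_of_nonneg (Real.exp_nonneg _)]

theorem weight_ne_zero (x : Phase) : P.weight x ≠ 0 := by
  rw [← norm_ne_zero_iff, norm_weight]
  exact (Real.exp_pos _).ne'

theorem norm_weight_sq (x : Phase) : ‖P.weight x‖ ^ 2 = Real.exp (-‖P.zNC x‖ ^ 2 / P.ℏ) := by
  have := P.ℏ_pos.ne'
  rw [norm_weight, ← Real.exp_nat_mul]
  congr 1
  push_cast
  field_simp

theorem conj_weight_mul_weight (x : Phase) :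
    starRingEnd ℂ (P.weight x) * P.weight x = (Real.exp (-‖P.zNC x‖ ^ 2 / P.ℏ) : ℂ) := by
  rw [← normSq_eq_conj_mul_self, normSq_eq_norm_sq, norm_weight_sq]

theorem continuous_weight : Continuous P.weight := by
  have := P.continuous_zNC
  unfold weight
  fun_prop

theorem continuous_transform {g : ℂ → ℂ} (hg : Continuous g) : Continuous (P.transform g) :=
  P.continuous_weight.mul (hg.comp P.continuous_zNC)

/-- The squared modulus of the weight is the Fock density up to the constant `πℏ`, and `z^NC` pushes
`ν̃` to `(πℏ)⁻¹ dA`. -/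
theorem memLp_transform (μ : Measure (ℝ × ℝ)) [IsProbabilityMeasure μ] {g : ℂ → ℂ}
    (hg : Continuous g) (hg2 : MemLp g 2 (fockMeasure P.ℏ)) : MemLp (P.transform g) 2 (P.nu μ) := by
  rw [memLp_two_iff_integrable_sq_norm (P.continuous_transform hg).aestronglyMeasurable]
  have h1 := (memLp_two_iff_integrable_sq_norm hg.aestronglyMeasurable).1 hg2
  rw [fockMeasure, integrable_withDensity_iff_integrable_smul'
    (measurable_fockDensity P.ℏ) (by simp)] at h1
  simp_rw [toReal_fockDensity P.ℏ_pos] at h1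
  have h2 := ((h1.smul_measure (c := ENNReal.ofReal (1 / (Real.pi * P.ℏ)))
    ENNReal.ofReal_ne_top).const_mul (Real.pi * P.ℏ))
  have h3 := (P.measurePreserving_zNC μ).integrable_comp_of_integrable h2
  refine h3.congr (.of_forall fun x => ?_)
  have := P.ℏ_pos.ne'
  simp only [Function.comp_apply, transform_apply, norm_mul, mul_pow, norm_weight_sq, smul_eq_mul]
  field_simp

/-- Matrix elements of multiplication by `F` between transforms. -/
theorem integral_conj_transform_mul (μ : Measure (ℝ × ℝ)) [IsProbabilityMeasure μ]
    {F : Phase → ℂ} (hF : MemLp F ⊤ (P.nu μ)) {k g : ℂ → ℂ} (hk : Continuous k)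
    (hk2 : MemLp k 2 (fockMeasure P.ℏ)) (hg : Continuous g) (hg2 : MemLp g 2 (fockMeasure P.ℏ)) :
    ∫ x, starRingEnd ℂ (P.transform k x) * (F x * P.transform g x) ∂P.nu μ =
      ∫ z, starRingEnd ℂ (k z) * (P.rho μ F z * g z) ∂fockMeasure P.ℏ := by
  have hi : Integrable (fun x => starRingEnd ℂ (P.transform k x) * (F x * P.transform g x))
      (P.nu μ) :=
    (P.memLp_transform μ hk hk2).star.integrable_mul
      ((P.memLp_transform μ hg hg2).mul (r := 2) hF)
  -- The phases of the two weights cancel, so in the chart only `F` depends on `w.2`; integrating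
  -- over it first produces `ϱF`.
  have e : ∀ w, starRingEnd ℂ (P.transform k (P.chart w)) *
      (F (P.chart w) * P.transform g (P.chart w)) =
      ((Real.exp (-‖w.1‖ ^ 2 / P.ℏ) : ℂ) * (starRingEnd ℂ (k w.1) * g w.1)) *
        F (P.chart w) := fun w => by
    have := P.conj_weight_mul_weight (P.chart w)
    rw [zNC_chart] at this
    rw [← this]
    simp only [transform_apply, zNC_chart, map_mul]
    ring
  have hpres := P.measurePreserving_chart μ
  have hi' : Integrable (fun w => starRingEnd ℂ (P.transform k (P.chart w)) *
      (F (P.chart w) * P.transform g (P.chart w))) (P.planeMeasure.prod μ) :=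
    hpres.integrable_comp_of_integrable hi
  rw [← hpres.integral_comp P.chartHomeomorph.measurableEmbedding, integral_prod _ hi',
    planeMeasure, integral_smul_measure, integral_fockMeasure P.ℏ_pos, ← integral_smul]
  congr 1 with z
  simp only [e, integral_const_mul]
  have := P.ℏ_pos
  rw [ENNReal.toReal_ofReal (by positivity), real_smul, rho_apply]
  push_cast
  ring

end Params

/-! ### The coherent state kernel and the unitary equivalence with the Fock space. -/

namespace Params

open Complex

variable (P : Params)

/-! ### The kernel in closed form -/

/-- In terms of `q^NC` and `p^NC` the variables `(q₂, p₂)` survive only in a phase independent of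
`r`, which is conjugate to the one in `weight`. -/
theorem coherentState_eq (x : Phase) (r : ℝ) :
    P.coherentState x r = exp (I * ((-(P.δ * x.2.1 + P.κ * P.ϑ * x.2.2 / P.ℏ)
      + (2 * P.κ - P.pNC x / P.ℏ) * r - P.qNC x * P.pNC x / (2 * P.ℏ) : ℝ) : ℂ)) *
      (P.groundState (r + P.qNC x) : ℂ) := by
  obtain ⟨⟨q₁, p₁⟩, ⟨q₂, p₂⟩⟩ := x
  have h1 := P.ℏ_pos.ne'
  have h2 := P.ϑ_ne
  simp only [coherentState, qNC, pNC]
  congr 3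
  · congr 1
    field_simp
    ring
  · ring

theorem groundState_mul_groundState (r t : ℝ) :
    P.groundState r * P.groundState t =
      1 / (√Real.pi * P.s) * Real.exp (-(r ^ 2 + t ^ 2) / (2 * P.s ^ 2)) := by
  have hs := P.s_pos
  have h1 : Real.pi ^ (1 / 4 : ℝ) * Real.pi ^ (1 / 4 : ℝ) = √Real.pi := by
    rw [← Real.rpow_add Real.pi_pos, Real.sqrt_eq_rpow]
    norm_num
  have h2 : P.s ^ (1 / 2 : ℝ) * P.s ^ (1 / 2 : ℝ) = P.s := by
    rw [← Real.rpow_add hs]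
    norm_num
  have h3 : Real.exp (-(r ^ 2 + t ^ 2) / (2 * P.s ^ 2)) =
      Real.exp (-r ^ 2 / (2 * P.s ^ 2)) * Real.exp (-t ^ 2 / (2 * P.s ^ 2)) := by
    rw [← Real.exp_add]
    congr 1
    ring
  rw [groundState, groundState, h3, ← h1]
  nth_rewrite 5 [← h2]
  field_simp

theorem kernel_eq (x y : Phase) :
    P.kernel x y = starRingEnd ℂ (P.weight y) *
      P.transform (fun z => exp (z * starRingEnd ℂ (P.zNC y) / P.ℏ)) x := by
  have hs := P.s_pos.ne'
  have hsC : (P.s : ℂ) ≠ 0 := by exact_mod_cast hs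
  set φ := P.δ * x.2.1 + P.κ * P.ϑ * x.2.2 / P.ℏ with hφ
  set ψ := P.δ * y.2.1 + P.κ * P.ϑ * y.2.2 / P.ℏ with hψ
  set a := P.qNC x with ha
  set b := P.qNC y with hb
  set p := P.pNC x with hp
  set q := P.pNC y with hq
  set t := √(2 * P.ℏ) with ht
  have ht0 : t ≠ 0 := P.sqrt_two_mul_pos.ne'
  have htC : (t : ℂ) ≠ 0 := by exact_mod_cast ht0
  -- Expressing `ℏ` through `t = √(2ℏ)` leaves no square roots in the exponents, whose comparison
  -- becomes a rational identity.
  have hℏ : P.ℏ = t ^ 2 / 2 := by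
    rw [ht, Real.sq_sqrt (by linarith [P.ℏ_pos])]
    ring
  have hint : ∀ r : ℝ, starRingEnd ℂ (P.coherentState x r) * P.coherentState y r =
      (1 / (√Real.pi * P.s) : ℝ) * exp ((-(1 / P.s ^ 2) : ℂ) * (r : ℂ) ^ 2 +
        (-(a + b) / P.s ^ 2 + I * (p - q) / P.ℏ) * (r : ℂ) +
        (-(a ^ 2 + b ^ 2) / (2 * P.s ^ 2) + I * (φ - ψ + (a * p - b * q) / (2 * P.ℏ)))) := by
    intro r
    have hgg := congrArg (fun u : ℝ => (u : ℂ)) (P.groundState_mul_groundState (r + a) (r + b))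
    simp only [ofReal_mul] at hgg
    rw [coherentState_eq, coherentState_eq, ← hφ, ← hψ, ← ha, ← hb, ← hp, ← hq, map_mul, ← exp_conj, map_mul, conj_I, conj_ofReal,
      conj_ofReal, mul_mul_mul_comm, hgg, ← exp_add, mul_left_comm, ofReal_exp, ← exp_add]
    congr 2
    push_cast
    rw [hℏ]
    push_cast
    field_simp
    ring
  have hre : (-(1 / (P.s : ℂ) ^ 2)).re < 0 := by
    rw [show (-(1 / (P.s : ℂ) ^ 2)) = ((-(1 / P.s ^ 2) : ℝ) : ℂ) by push_cast; ring, ofReal_re]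
    have := P.s_pos
    have : 0 < 1 / P.s ^ 2 := by positivity
    linarith
  -- The prefactor of the Gaussian integral cancels the normalization of the ground states.
  have hroot : ((Real.pi : ℂ) / -(-(1 / (P.s : ℂ) ^ 2))) ^ (1 / 2 : ℂ) =
      ((√Real.pi * P.s : ℝ) : ℂ) := by
    rw [show ((Real.pi : ℂ) / -(-(1 / (P.s : ℂ) ^ 2))) = ((Real.pi * P.s ^ 2 : ℝ) : ℂ) by
      push_cast; field_simp, show (1 / 2 : ℂ) = ((1 / 2 : ℝ) : ℂ) by push_cast; ring,
      ← ofReal_cpow (by positivity), ← Real.sqrt_eq_rpow, Real.sqrt_mul Real.pi_pos.le,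
      Real.sqrt_sq P.s_pos.le]
  have hnorm : ∀ u : Phase, ‖P.zNC u‖ ^ 2 =
      (t / 2 * P.qNC u / P.s) ^ 2 + (P.s * P.pNC u / t) ^ 2 := fun u => by
    rw [← normSq_eq_norm_sq, normSq_apply, zNC_re, zNC_im, sqrt_half]
    ring
  have hz : ∀ u : Phase, P.zNC u =
      (t / 2 * P.qNC u / P.s : ℂ) - I * (P.s * P.pNC u / t) := fun u => by
    rw [zNC, sqrt_half]
    push_cast
    rfl
  have hzc : starRingEnd ℂ (P.zNC y) = (t / 2 * b / P.s : ℂ) + I * (P.s * q / t) := by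
    rw [hz]
    simp only [map_sub, map_mul, map_div₀, conj_I, conj_ofReal, map_ofNat]
    ring
  rw [kernel]
  simp only [hint]
  rw [integral_const_mul, integral_cexp_quadratic hre, hroot, ← mul_assoc, ← ofReal_mul,
    one_div_mul_cancel (mul_ne_zero (Real.sqrt_pos.2 Real.pi_pos).ne' hs), ofReal_one, one_mul,
    transform_apply, weight, weight, map_mul, ← exp_conj, map_mul, conj_I, conj_ofReal, conj_ofReal,
    ofReal_exp, ofReal_exp, ← exp_add, ← exp_add, ← exp_add, ← exp_add, hnorm, hnorm, hzc, hz x,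
    ← hφ, ← hψ, ← ha, ← hb, ← hp, ← hq, hℏ]
  congr 1
  push_cast
  field_simp
  ring_nf
  simp only [I_sq]
  ring

theorem memLp_top_mono_ac {X : Type*} [MeasurableSpace X] {m n : Measure X} {F : X → ℂ}
    (hF : MemLp F ⊤ n) (h : m ≪ n) : MemLp F ⊤ m := by
  refine ⟨hF.1.mono_ac h, lt_of_le_of_lt ?_ hF.2⟩
  rw [eLpNorm_exponent_top, eLpNorm_exponent_top]
  exact eLpNormEssSup_mono_measure F h

/-! ### The unitary isomorphism and the reproducing kernel structure -/

section Unitary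

variable (μ : Measure (ℝ × ℝ)) [IsProbabilityMeasure μ]

theorem entireRep_add (u v : fockSpace P.ℏ) : entireRep (u + v) = entireRep u + entireRep v := by
  funext z
  rw [Pi.add_apply, ← inner_kernelVec P.ℏ_pos, ← inner_kernelVec P.ℏ_pos, ← inner_kernelVec P.ℏ_pos]
  exact inner_add_right (𝕜 := ℂ) (kernelVec P.ℏ_pos z) u v

theorem entireRep_smul (c : ℂ) (u : fockSpace P.ℏ) : entireRep (c • u) = c • entireRep u := by
  funext z
  rw [Pi.smul_apply, ← inner_kernelVec P.ℏ_pos, ← inner_kernelVec P.ℏ_pos]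
  exact inner_smul_right (kernelVec P.ℏ_pos z) u c

theorem memLp_transform_entireRep (u : fockSpace P.ℏ) :
    MemLp (P.transform (entireRep u)) 2 (P.nu μ) :=
  P.memLp_transform μ (differentiable_entireRep u).continuous (memLp_entireRep u)

/-- The transform as a linear map from the Fock space to `L²(ν̃)`. -/
noncomputable def transformLM : fockSpace P.ℏ →ₗ[ℂ] Lp ℂ 2 (P.nu μ) where
  toFun u := (P.memLp_transform_entireRep μ u).toLp
  map_add' u v := by
    rw [← MemLp.toLp_add]
    refine MemLp.toLp_congr _ _ (.of_forall fun x => ?_)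
    simp only [transform_apply, entireRep_add, Pi.add_apply, mul_add]
  map_smul' c u := by
    rw [RingHom.id_apply, ← MemLp.toLp_const_smul]
    refine MemLp.toLp_congr _ _ (.of_forall fun x => ?_)
    simp only [transform_apply, entireRep_smul, Pi.smul_apply, smul_eq_mul]
    ring

theorem coeFn_transformLM (u : fockSpace P.ℏ) :
    P.transformLM μ u =ᵐ[P.nu μ] P.transform (entireRep u) :=
  (P.memLp_transform_entireRep μ u).coeFn_toLp

theorem integral_conj_transformLM_mul {F : Phase → ℂ} (hF : MemLp F ⊤ (P.nu μ))
    (v u : fockSpace P.ℏ) :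
    ∫ x, starRingEnd ℂ (P.transformLM μ v x) * (F x * P.transformLM μ u x) ∂P.nu μ =
      inner ℂ v (toeplitz (fockSpace P.ℏ) (P.rho μ F) u) := by
  have hρ : MemLp (P.rho μ F) ⊤ (fockMeasure P.ℏ) :=
    memLp_top_mono_ac (P.memLp_rho μ hF) (fockMeasure_absolutelyContinuous _)
  rw [inner_toeplitz _ hρ]
  have h1 := P.integral_conj_transform_mul μ hF (differentiable_entireRep v).continuous
    (memLp_entireRep v) (differentiable_entireRep u).continuous (memLp_entireRep u)
  refine Eq.trans (integral_congr_ae ?_) (h1.trans (integral_congr_ae ?_))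
  · filter_upwards [P.coeFn_transformLM μ v, P.coeFn_transformLM μ u] with x hv hu
    rw [hv, hu]
  · filter_upwards [coeFn_ae_eq_entireRep v, coeFn_ae_eq_entireRep u] with z hv hu
    rw [hv, hu]

/-- This is the matrix element formula for the constant symbol `1 = wave 0`, which `ϱ` preserves. -/
theorem inner_transformLM (v u : fockSpace P.ℏ) :
    inner ℂ (P.transformLM μ v) (P.transformLM μ u) = inner ℂ v u := by
  have h1 : MemLp (wave 0 ∘ P.zNC) ⊤ (P.nu μ) :=
    (memLp_wave 0 _).comp_measurePreserving (P.measurePreserving_zNC μ)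
  have h2 := P.integral_conj_transformLM_mul μ h1 v u
  have h3 : P.rho μ (wave 0 ∘ P.zNC) = wave 0 := by
    funext z
    simp [rho_apply, wave_zero]
  rw [h3, toeplitz_wave_zero, ContinuousLinearMap.id_apply] at h2
  rw [L2.inner_def, ← h2]
  congr 1 with x
  simp [wave_zero, mul_comm]

theorem norm_transformLM (u : fockSpace P.ℏ) : ‖P.transformLM μ u‖ = ‖u‖ := by
  have h1 := inner_self_eq_norm_sq_to_K (𝕜 := ℂ) (P.transformLM μ u)
  have h2 := inner_self_eq_norm_sq_to_K (𝕜 := ℂ) u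
  rw [inner_transformLM] at h1
  have h3 : ((‖P.transformLM μ u‖ : ℂ)) ^ 2 = (‖u‖ : ℂ) ^ 2 := h1.symm.trans h2
  exact (sq_eq_sq₀ (norm_nonneg _) (norm_nonneg _)).1 (by exact_mod_cast h3)

/-- The transform as an isometry from the Fock space to `L²(ν̃)`. -/
noncomputable def transformLI : fockSpace P.ℏ →ₗᵢ[ℂ] Lp ℂ 2 (P.nu μ) :=
  ⟨P.transformLM μ, P.norm_transformLM μ⟩

theorem coeFn_transformLM_kernelVec (y : Phase) :
    ((starRingEnd ℂ (P.weight y) • P.transformLM μ (kernelVec P.ℏ_pos (P.zNC y)) :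
      Lp ℂ 2 (P.nu μ)) : Phase → ℂ) =ᵐ[P.nu μ] fun x => P.kernel x y := by
  filter_upwards [Lp.coeFn_smul (starRingEnd ℂ (P.weight y))
    (P.transformLM μ (kernelVec P.ℏ_pos (P.zNC y))),
    P.coeFn_transformLM μ (kernelVec P.ℏ_pos (P.zNC y))] with x h1 h2
  rw [h1, Pi.smul_apply, h2, entireRep_kernelVec, kernel_eq, smul_eq_mul]

theorem transformLM_kernelVec_mem (z : ℂ) :
    P.transformLM μ (kernelVec P.ℏ_pos z) ∈ P.rkSpace μ := by
  obtain ⟨y, rfl⟩ := P.zNC_surjective z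
  have h1 : starRingEnd ℂ (P.weight y) • P.transformLM μ (kernelVec P.ℏ_pos (P.zNC y)) ∈
      P.rkSpace μ :=
    Submodule.le_topologicalClosure _
      (Submodule.subset_span ⟨y, P.coeFn_transformLM_kernelVec μ y⟩)
  have h2 : starRingEnd ℂ (P.weight y) ≠ 0 := by simpa using P.weight_ne_zero y
  exact (Submodule.smul_mem_iff _ h2).1 h1

/-- As `z^NC` is onto and the weight never vanishes, every kernel vector of the Fock space maps to a
multiple of some `K̃(·, y)`; density and continuity do the rest. -/
theorem transformLM_mem (u : fockSpace P.ℏ) : P.transformLM μ u ∈ P.rkSpace μ := by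
  have hcl : IsClosed ((P.rkSpace μ).comap (P.transformLM μ) : Set (fockSpace P.ℏ)) :=
    (Submodule.isClosed_topologicalClosure _).preimage (P.transformLI μ).continuous
  have h1 : (Submodule.span ℂ (Set.range (kernelVec P.ℏ_pos))).topologicalClosure ≤
      (P.rkSpace μ).comap (P.transformLM μ) := by
    refine Submodule.topologicalClosure_minimal _ (Submodule.span_le.2 ?_) hcl
    rintro _ ⟨z, rfl⟩
    exact P.transformLM_kernelVec_mem μ z
  rw [topologicalClosure_span_kernelVec] at h1
  exact h1 Submodule.mem_top

theorem rkSpace_le_range : P.rkSpace μ ≤ LinearMap.range (P.transformLM μ) := by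
  refine Submodule.topologicalClosure_minimal _ (Submodule.span_le.2 ?_) ?_
  · rintro u ⟨y, hu⟩
    refine ⟨starRingEnd ℂ (P.weight y) • kernelVec P.ℏ_pos (P.zNC y), ?_⟩
    rw [map_smul]
    exact Lp.ext ((P.coeFn_transformLM_kernelVec μ y).trans hu.symm)
  -- The Fock space is complete, so its isometric image is closed and contains the closed span.
  · have h := (P.transformLI μ).isometry.isClosedEmbedding.isClosed_range
    exact h

/-- The unitary isomorphism of the Fock space onto the reproducing kernel space. -/
noncomputable def unitary : fockSpace P.ℏ ≃ₗᵢ[ℂ] P.rkSpace μ :=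
  LinearIsometryEquiv.ofSurjective
    ⟨(P.transformLM μ).codRestrict (P.rkSpace μ) (P.transformLM_mem μ), P.norm_transformLM μ⟩
    fun u => by
      obtain ⟨f, hf⟩ := P.rkSpace_le_range μ u.2
      exact ⟨f, Subtype.ext hf⟩

theorem coe_unitary (u : fockSpace P.ℏ) :
    (P.unitary μ u : Lp ℂ 2 (P.nu μ)) = P.transformLM μ u := rfl

/-- The kernel function `K̃(·, x)` as an element of the reproducing kernel space. -/
noncomputable def kernelFun (x : Phase) : P.rkSpace μ :=
  P.unitary μ (starRingEnd ℂ (P.weight x) • kernelVec P.ℏ_pos (P.zNC x))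

theorem inner_kernelFun_unitary (x : Phase) (f : fockSpace P.ℏ) :
    inner ℂ (P.kernelFun μ x) (P.unitary μ f) = P.transform (entireRep f) x := by
  have h1 : inner ℂ (P.kernelFun μ x) (P.unitary μ f) =
      inner ℂ (starRingEnd ℂ (P.weight x) • kernelVec P.ℏ_pos (P.zNC x)) f :=
    P.inner_transformLM μ _ _
  rw [h1, transform_apply, ← inner_kernelVec P.ℏ_pos]
  refine (inner_smul_left (kernelVec P.ℏ_pos (P.zNC x)) f _).trans ?_
  rw [conj_conj]

/-- The reproducing kernel Hilbert space structure: evaluation at `x` is the inner product with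
`K̃(·, x)`. -/
noncomputable abbrev rkhs : RKHS ℂ (P.rkSpace μ) Phase ℂ where
  coeCLM := ContinuousLinearMap.pi fun x => innerSL ℂ (P.kernelFun μ x)
  coeCLM_injective := by
    intro u v huv
    obtain ⟨f, rfl⟩ := (P.unitary μ).surjective u
    obtain ⟨g, rfl⟩ := (P.unitary μ).surjective v
    congr 1
    refine entireRep_injective (funext fun z => ?_)
    obtain ⟨x, rfl⟩ := P.zNC_surjective z
    have h1 : inner ℂ (P.kernelFun μ x) (P.unitary μ f) =
      inner ℂ (P.kernelFun μ x) (P.unitary μ g) := congrFun huv x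
    rw [inner_kernelFun_unitary, inner_kernelFun_unitary, transform_apply, transform_apply] at h1
    exact mul_left_cancel₀ (P.weight_ne_zero x) h1

theorem rkhs_coeCLM_apply (u : P.rkSpace μ) (x : Phase) :
    (P.rkhs μ).coeCLM u x = inner ℂ (P.kernelFun μ x) u := rfl

theorem rkhs_coeCLM_unitary (f : fockSpace P.ℏ) :
    (P.rkhs μ).coeCLM (P.unitary μ f) = P.transform (entireRep f) :=
  funext fun x => P.inner_kernelFun_unitary μ x f

theorem isRKHSWithKernel :
    letI := P.rkhs μ
    IsRKHSWithKernel (P.rkSpace μ) P.kernel := by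
  let := P.rkhs μ
  refine ⟨fun u => ?_, fun x y => ?_⟩
  · obtain ⟨f, rfl⟩ := (P.unitary μ).surjective u
    rw [coe_unitary]
    refine (P.coeFn_transformLM μ f).trans (.of_forall fun x => ?_)
    exact (congrFun (P.rkhs_coeCLM_unitary μ f) x).symm
  · have h1 : RKHS.kerFun (P.rkSpace μ) y 1 = P.kernelFun μ y := by
      refine ext_inner_right ℂ fun u => ?_
      rw [RKHS.kerFun_inner]
      refine Eq.trans ?_ (P.rkhs_coeCLM_apply μ u y)
      simp
    rw [← RKHS.kerFun_apply, h1]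
    refine (congrFun (P.rkhs_coeCLM_unitary μ _) x).trans ?_
    rw [entireRep_smul, entireRep_kernelVec, kernel_eq, transform_apply, transform_apply,
      Pi.smul_apply, smul_eq_mul]
    ring

theorem inner_unitary_toeplitz {F : Phase → ℂ} (hF : MemLp F ⊤ (P.nu μ)) (v u : fockSpace P.ℏ) :
    inner ℂ (P.unitary μ v) (toeplitz (P.rkSpace μ) F (P.unitary μ u)) =
      inner ℂ v (toeplitz (fockSpace P.ℏ) (P.rho μ F) u) := by
  rw [inner_toeplitz _ hF, coe_unitary, coe_unitary, integral_conj_transformLM_mul P μ hF]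

/-- This intertwining relation transports the star product expansion from the Fock space. -/
theorem toeplitz_unitary {F : Phase → ℂ} (hF : MemLp F ⊤ (P.nu μ)) (u : fockSpace P.ℏ) :
    toeplitz (P.rkSpace μ) F (P.unitary μ u) =
      P.unitary μ (toeplitz (fockSpace P.ℏ) (P.rho μ F) u) := by
  refine ext_inner_left ℂ fun w => ?_
  obtain ⟨v, rfl⟩ := (P.unitary μ).surjective w
  rw [inner_unitary_toeplitz P μ hF]
  exact ((P.unitary μ).inner_map_map _ _).symm

theorem adjoint_unitary_comp_toeplitz_comp {F : Phase → ℂ} (hF : MemLp F ⊤ (P.nu μ)) :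
    ((P.unitary μ).toContinuousLinearEquiv : fockSpace P.ℏ →L[ℂ] P.rkSpace μ).adjoint ∘L
      toeplitz (P.rkSpace μ) F ∘L
      ((P.unitary μ).toContinuousLinearEquiv : fockSpace P.ℏ →L[ℂ] P.rkSpace μ) =
      toeplitz (fockSpace P.ℏ) (P.rho μ F) := by
  refine ContinuousLinearMap.ext fun u => ext_inner_left ℂ fun v => ?_
  set A : fockSpace P.ℏ →L[ℂ] P.rkSpace μ :=
    (P.unitary μ).toContinuousLinearEquiv.toContinuousLinearMap
  have h1 := ContinuousLinearMap.adjoint_inner_right A v (toeplitz (P.rkSpace μ) F (A u))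
  have h2 : inner ℂ (A v) (toeplitz (P.rkSpace μ) F (A u)) =
      inner ℂ v (toeplitz (fockSpace P.ℏ) (P.rho μ F) u) := P.inner_unitary_toeplitz μ hF v u
  exact h1.trans h2

end Unitary

end Params

/-! ### Smooth superpositions of plane waves -/

section WavePairing

open Complex
open scoped FourierTransform

variable {V : Type*} [NormedAddCommGroup V] [NormedSpace ℝ V]

/-- The pairing for which the plane waves with frequency `a ξ` are the Fourier characters. -/
noncomputable def wavePairing (a : V →L[ℝ] ℂ) : V →L[ℝ] ℂ →L[ℝ] ℝ :=
  (-(1 / Real.pi)) • ((innerSL ℝ : ℂ →L[ℝ] ℂ →L[ℝ] ℝ) ∘L a)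

theorem wavePairing_apply (a : V →L[ℝ] ℂ) (ξ : V) (z : ℂ) :
    wavePairing a ξ z = -(1 / Real.pi) * ((a ξ).re * z.re + (a ξ).im * z.im) := by
  have h : innerSL ℝ (a ξ) z = (a ξ).re * z.re + (a ξ).im * z.im := by
    rw [innerSL_apply_apply, Complex.inner]
    simp [mul_comm]
  rw [← h]
  rfl

/-- As `a z̄ + ā z = 2 (Re a Re z + Im a Im z)` and `𝐞 t = exp (2πit)`, the constant has to be
`1/π`; its sign follows the convention of `VectorFourier.fourierIntegral`. -/
theorem fourierChar_neg_wavePairing (a : V →L[ℝ] ℂ) (ξ : V) (z : ℂ) :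
    (𝐞 (-wavePairing a ξ z) : ℂ) = wave (a ξ) z := by
  have hπ : Real.pi ≠ 0 := Real.pi_ne_zero
  rw [Real.fourierChar_apply, wavePairing_apply, wave]
  congr 1
  rw [mul_comm I]
  congr 1
  apply Complex.ext
  · simp only [ofReal_re, add_re, mul_re, conj_re, conj_im]
    field_simp
    ring
  · simp only [ofReal_im, add_im, mul_im, conj_re, conj_im]
    ring

theorem waveIntegral_eq_fourierIntegral [MeasurableSpace V] (m : Measure V) (c : V → ℂ) (a : V →L[ℝ] ℂ) :
    waveIntegral m c a =
      VectorFourier.fourierIntegral 𝐞 m (wavePairing a).toLinearMap₁₂ c := by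
  funext z
  rw [waveIntegral, VectorFourier.fourierIntegral]
  congr 1 with ξ
  rw [Circle.smul_def, ContinuousLinearMap.toLinearMap₁₂_apply_apply_apply,
    fourierChar_neg_wavePairing, smul_eq_mul, mul_comm]

end WavePairing

/-! ### Smoothness and Wirtinger derivatives of superpositions. -/

section SmoothSuperposition

open Complex
open scoped FourierTransform

variable {V : Type*} [NormedAddCommGroup V] [MeasurableSpace V] {m : Measure V}

/-- A function all of whose moments are absolutely integrable. -/
def HasMoments (m : Measure V) (c : V → ℂ) : Prop :=
  AEStronglyMeasurable c m ∧ ∀ k : ℕ, Integrable (fun ξ => ‖ξ‖ ^ k * ‖c ξ‖) m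

theorem HasMoments.integrable {c : V → ℂ} (hc : HasMoments m c) : Integrable c m :=
  (hc.2 0).mono' hc.1 (.of_forall fun ξ => by simp)

variable [BorelSpace V]

theorem HasMoments.mono {c d : V → ℂ} (hd : HasMoments m d) (hc : AEStronglyMeasurable c m)
    (h : ∀ ξ, ‖c ξ‖ ≤ ‖d ξ‖) : HasMoments m c := by
  refine ⟨hc, fun k => (hd.2 k).mono'
    ((continuous_norm.pow k).aestronglyMeasurable.mul hc.norm) (.of_forall fun ξ => ?_)⟩
  rw [Real.norm_of_nonneg (by positivity)]
  gcongr
  exact h ξ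

theorem HasMoments.mul_linear {c : V → ℂ} (hc : HasMoments m c) {l : V → ℂ} (hl : Continuous l)
    {C : ℝ} (hC : ∀ ξ, ‖l ξ‖ ≤ C * ‖ξ‖) : HasMoments m (fun ξ => l ξ * c ξ) := by
  have hm : AEStronglyMeasurable (fun ξ => l ξ * c ξ) m := hl.aestronglyMeasurable.mul hc.1
  refine ⟨hm, fun k => ((hc.2 (k + 1)).const_mul C).mono'
    ((continuous_norm.pow k).aestronglyMeasurable.mul hm.norm) (.of_forall fun ξ => ?_)⟩
  rw [Real.norm_of_nonneg (by positivity), norm_mul]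
  calc ‖ξ‖ ^ k * (‖l ξ‖ * ‖c ξ‖) ≤ ‖ξ‖ ^ k * (C * ‖ξ‖ * ‖c ξ‖) := by gcongr; exact hC ξ
    _ = _ := by ring

variable [NormedSpace ℝ V]

theorem HasMoments.integrable_pow_mul {c : V → ℂ} (hc : HasMoments m c) (a : V →L[ℝ] ℂ) (k : ℕ) :
    Integrable (fun ξ => ‖a ξ‖ ^ k * ‖c ξ‖) m := by
  refine ((hc.2 k).const_mul (‖a‖ ^ k)).mono'
    ((a.continuous.norm.pow k).aestronglyMeasurable.mul hc.1.norm) (.of_forall fun ξ => ?_)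
  rw [Real.norm_of_nonneg (by positivity), ← mul_assoc, ← mul_pow]
  gcongr
  exact a.le_opNorm ξ

theorem HasMoments.mul_I_mul_conj {c : V → ℂ} (hc : HasMoments m c) (a : V →L[ℝ] ℂ) :
    HasMoments m (fun ξ => I * starRingEnd ℂ (a ξ) * c ξ) :=
  hc.mul_linear (continuous_const.mul (continuous_conj.comp a.continuous)) (C := ‖a‖) fun ξ => by simpa using a.le_opNorm ξ

theorem HasMoments.mul_I_mul {c : V → ℂ} (hc : HasMoments m c) (a : V →L[ℝ] ℂ) :
    HasMoments m (fun ξ => I * a ξ * c ξ) :=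
  hc.mul_linear (continuous_const.mul a.continuous) (C := ‖a‖)
    fun ξ => by simpa using a.le_opNorm ξ

theorem HasMoments.mul_real {c : V → ℂ} (hc : HasMoments m c) (a : V →L[ℝ] ℂ) (v : ℂ) :
    HasMoments m (fun ξ => 2 * I * ((a ξ).re * v.re + (a ξ).im * v.im : ℝ) * c ξ) := by
  refine hc.mul_linear (l := fun ξ => 2 * I * ((a ξ).re * v.re + (a ξ).im * v.im : ℝ))
    (by fun_prop) (C := 2 * (‖a‖ * |v.re| + ‖a‖ * |v.im|)) fun ξ => ?_
  have h1 := (abs_re_le_norm (a ξ)).trans (a.le_opNorm ξ)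
  have h2 := (abs_im_le_norm (a ξ)).trans (a.le_opNorm ξ)
  rw [norm_mul, norm_mul, norm_I, norm_real, Real.norm_eq_abs, mul_one, norm_ofNat, mul_assoc]
  refine mul_le_mul_of_nonneg_left ((abs_add_le _ _).trans ?_) (by norm_num)
  rw [abs_mul, abs_mul, add_mul]
  calc |(a ξ).re| * |v.re| + |(a ξ).im| * |v.im|
      ≤ ‖a‖ * ‖ξ‖ * |v.re| + ‖a‖ * ‖ξ‖ * |v.im| := by gcongr
    _ = _ := by ring

theorem integrable_mul_wave {c : V → ℂ} (hc : HasMoments m c) (a : V →L[ℝ] ℂ) (z : ℂ) :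
    Integrable (fun ξ => c ξ * wave (a ξ) z) m :=
  hc.integrable.norm.mono' (aestronglyMeasurable_mul_wave hc.1 a.continuous.measurable z)
    (.of_forall fun ξ => by simp [norm_wave])

variable [SecondCountableTopology V]

theorem contDiff_waveIntegral {c : V → ℂ} (hc : HasMoments m c) (a : V →L[ℝ] ℂ) :
    ContDiff ℝ (⊤ : ℕ∞) (waveIntegral m c a) := by
  rw [waveIntegral_eq_fourierIntegral]
  exact VectorFourier.contDiff_fourierIntegral _ fun n _ => hc.2 n

theorem fderiv_waveIntegral {c : V → ℂ} (hc : HasMoments m c) (a : V →L[ℝ] ℂ) (z v : ℂ) :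
    fderiv ℝ (waveIntegral m c a) z v =
      waveIntegral m (fun ξ => 2 * I * ((a ξ).re * v.re + (a ξ).im * v.im : ℝ) * c ξ) a z := by
  have h1 : Integrable (fun ξ => ‖ξ‖ * ‖c ξ‖) m := by simpa using hc.2 1
  have hi : Integrable (VectorFourier.fourierSMulRight (wavePairing a) c) m := by
    refine (h1.const_mul (2 * Real.pi * ‖wavePairing a‖)).mono' hc.1.fourierSMulRight
      (.of_forall fun ξ => ?_)
    exact (VectorFourier.norm_fourierSMulRight_le _ _ _).trans_eq (by ring)
  rw [waveIntegral_eq_fourierIntegral,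
    (VectorFourier.hasFDerivAt_fourierIntegral (wavePairing a) hc.integrable h1 z).fderiv,
    VectorFourier.fourierIntegral_continuousLinearMap_apply Real.continuous_fourierChar hi,
    waveIntegral_eq_fourierIntegral]
  congr 1
  funext ξ
  have hπ : (Real.pi : ℂ) ≠ 0 := by exact_mod_cast Real.pi_ne_zero
  rw [VectorFourier.fourierSMulRight_apply, wavePairing_apply]
  simp only [real_smul, smul_eq_mul]
  push_cast
  field_simp

theorem dz_waveIntegral {c : V → ℂ} (hc : HasMoments m c) (a : V →L[ℝ] ℂ) :
    dz (waveIntegral m c a) =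
      waveIntegral m (fun ξ => I * starRingEnd ℂ (a ξ) * c ξ) a := by
  funext z
  rw [dz, fderiv_waveIntegral hc, fderiv_waveIntegral hc, waveIntegral, waveIntegral, waveIntegral,
    ← integral_const_mul, ← integral_sub (integrable_mul_wave (hc.mul_real a _) a z)
      ((integrable_mul_wave (hc.mul_real a _) a z).const_mul I), ← integral_div]
  congr 1 with ξ
  have h1 : starRingEnd ℂ (a ξ) = (a ξ).re - (a ξ).im * I := by
    apply Complex.ext <;> simp
  rw [h1]
  simp only [one_re, one_im, I_re, I_im, mul_one, mul_zero, add_zero, zero_add]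
  ring

theorem dzbar_waveIntegral {c : V → ℂ} (hc : HasMoments m c) (a : V →L[ℝ] ℂ) :
    dzbar (waveIntegral m c a) = waveIntegral m (fun ξ => I * a ξ * c ξ) a := by
  funext z
  rw [dzbar, fderiv_waveIntegral hc, fderiv_waveIntegral hc, waveIntegral, waveIntegral,
    waveIntegral,
    ← integral_const_mul, ← integral_add (integrable_mul_wave (hc.mul_real a _) a z)
      ((integrable_mul_wave (hc.mul_real a _) a z).const_mul I), ← integral_div]
  congr 1 with ξ
  have h1 : a ξ = (a ξ).re + (a ξ).im * I := (re_add_im _).symm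
  nth_rewrite 7 [h1]
  simp only [one_re, one_im, I_re, I_im, mul_one, mul_zero, add_zero, zero_add]
  ring

/-- The moments are part of the induction, since each differentiation under the integral needs those
of the current amplitude. -/
theorem iterate_dz_waveIntegral {c : V → ℂ} (hc : HasMoments m c) (a : V →L[ℝ] ℂ) (j : ℕ) :
    HasMoments m (fun ξ => (I * starRingEnd ℂ (a ξ)) ^ j * c ξ) ∧
      dz^[j] (waveIntegral m c a) =
        waveIntegral m (fun ξ => (I * starRingEnd ℂ (a ξ)) ^ j * c ξ) a := by
  induction j with
  | zero => simpa using hc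
  | succ j ih =>
    have e : (fun ξ => (I * starRingEnd ℂ (a ξ)) ^ (j + 1) * c ξ) =
        fun ξ => I * starRingEnd ℂ (a ξ) * ((I * starRingEnd ℂ (a ξ)) ^ j * c ξ) := by
      funext ξ
      ring
    rw [Function.iterate_succ_apply', ih.2, dz_waveIntegral ih.1, e]
    exact ⟨ih.1.mul_I_mul_conj a, rfl⟩

theorem iterate_dzbar_waveIntegral {c : V → ℂ} (hc : HasMoments m c) (a : V →L[ℝ] ℂ) (j : ℕ) :
    HasMoments m (fun ξ => (I * a ξ) ^ j * c ξ) ∧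
      dzbar^[j] (waveIntegral m c a) = waveIntegral m (fun ξ => (I * a ξ) ^ j * c ξ) a := by
  induction j with
  | zero => simpa using hc
  | succ j ih =>
    have e : (fun ξ => (I * a ξ) ^ (j + 1) * c ξ) =
        fun ξ => I * a ξ * ((I * a ξ) ^ j * c ξ) := by
      funext ξ
      ring
    rw [Function.iterate_succ_apply', ih.2, dzbar_waveIntegral ih.1, e]
    exact ⟨ih.1.mul_I_mul a, rfl⟩

theorem starCoeff_waveIntegral {c d : V → ℂ} (hc : HasMoments m c) (hd : HasMoments m d)
    (a b : V →L[ℝ] ℂ) (j : ℕ) :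
    starCoeff j (waveIntegral m c a) (waveIntegral m d b) = fun z =>
      (-1) ^ j / (j.factorial : ℂ) *
        waveIntegral m (fun ξ => (I * starRingEnd ℂ (a ξ)) ^ j * c ξ) a z *
        waveIntegral m (fun ξ => (I * b ξ) ^ j * d ξ) b z := by
  funext z
  rw [starCoeff, (iterate_dz_waveIntegral hc a j).2, (iterate_dzbar_waveIntegral hd b j).2]

theorem memLp_starCoeff_waveIntegral {c d : V → ℂ} (hc : HasMoments m c) (hd : HasMoments m d)
    (a b : V →L[ℝ] ℂ) (j : ℕ) (ν : Measure ℂ) :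
    MemLp (starCoeff j (waveIntegral m c a) (waveIntegral m d b)) ⊤ ν := by
  rw [starCoeff_waveIntegral hc hd]
  have h1 := memLp_waveIntegral (iterate_dz_waveIntegral hc a j).1.integrable
    a.continuous.measurable ν
  have h2 := memLp_waveIntegral (iterate_dzbar_waveIntegral hd b j).1.integrable
    b.continuous.measurable ν
  exact h2.mul (h1.const_mul _)

end SmoothSuperposition

/-! ### Fourier representation of smooth symbols -/

section FourierRepresentation

open Complex
open scoped FourierTransform InnerProductSpace SchwartzMap

/-- Linear coordinates on the phase space in which it is a Euclidean space. -/
noncomputable def phaseEquiv : EuclideanSpace ℝ (Fin 4) ≃L[ℝ] Phase :=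
  ContinuousLinearEquiv.ofFinrankEq (by simp)

/-- Fourier inversion for a Schwartz function. The amplitude depends on `F` alone and not on the
parameters, which is what makes the final constant uniform. -/
theorem exists_fourier_representation {F : Phase → ℂ} (hF : ContDiff ℝ (⊤ : ℕ∞) F)
    (hF' : HasCompactSupport F) :
    ∃ ψ : 𝓢(EuclideanSpace ℝ (Fin 4), ℂ), ∀ x,
      F x = ∫ ξ, (𝐞 ⟪ξ, phaseEquiv.symm x⟫_ℝ : ℂ) * ψ ξ := by
  have h1 : HasCompactSupport (F ∘ phaseEquiv) :=
    hF'.comp_homeomorph phaseEquiv.toHomeomorph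
  have h2 : ContDiff ℝ (⊤ : ℕ∞) (F ∘ phaseEquiv) := hF.comp phaseEquiv.contDiff
  refine ⟨𝓕 (h1.toSchwartzMap h2), fun x => ?_⟩
  have h3 : 𝓕⁻ (𝓕 (h1.toSchwartzMap h2) : 𝓢(EuclideanSpace ℝ (Fin 4), ℂ)) = h1.toSchwartzMap h2 :=
    FourierTransform.fourierInv_fourier_eq _
  have h4 := congrArg (fun f : 𝓢(EuclideanSpace ℝ (Fin 4), ℂ) => f (phaseEquiv.symm x)) h3
  simp only [SchwartzMap.fourierInv_coe, Real.fourierInv_eq] at h4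
  have h5 : h1.toSchwartzMap h2 (phaseEquiv.symm x) = F x := by simp
  rw [← h5, ← h4]
  rfl

theorem hasMoments_schwartz (ψ : 𝓢(EuclideanSpace ℝ (Fin 4), ℂ)) : HasMoments volume ψ :=
  ⟨ψ.continuous.aestronglyMeasurable, fun k => ψ.integrable_pow_mul volume k⟩

namespace Params

/-- The map `z ↦ ((α Re z, β Im z), 0)` into the phase space, in Euclidean coordinates. -/
noncomputable def slopeMap (α β : ℝ) : ℂ →L[ℝ] EuclideanSpace ℝ (Fin 4) :=
  (phaseEquiv.symm : Phase →L[ℝ] EuclideanSpace ℝ (Fin 4)) ∘L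
    ((ContinuousLinearMap.prod (α • reCLM) (β • imCLM)).prod 0)

theorem slopeMap_apply (α β : ℝ) (z : ℂ) :
    slopeMap α β z = phaseEquiv.symm ((α * z.re, β * z.im), 0) := rfl

/-- The frequency of the plane wave `z ↦ exp (2πi ⟨ξ, slopeMap α β z⟩)`. -/
noncomputable def frequency (α β : ℝ) : EuclideanSpace ℝ (Fin 4) →L[ℝ] ℂ :=
  Real.pi • (slopeMap α β).adjoint

/-- The adjoint moves the slope map onto `ξ`; the factor in `frequency` is `π` rather than `2π`
because `a z̄ + ā z` is twice a real inner product. -/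
theorem wave_frequency (α β : ℝ) (ξ : EuclideanSpace ℝ (Fin 4)) (z : ℂ) :
    wave (frequency α β ξ) z = (𝐞 ⟪ξ, slopeMap α β z⟫_ℝ : ℂ) := by
  have h1 : ⟪ξ, slopeMap α β z⟫_ℝ = ⟪(slopeMap α β).adjoint ξ, z⟫_ℝ :=
    (ContinuousLinearMap.adjoint_inner_left _ _ _).symm
  rw [h1, Real.fourierChar_apply, wave, frequency, Complex.inner]
  congr 1
  rw [mul_comm I]
  congr 1
  simp only [smul_apply, real_smul]
  apply Complex.ext
  · simp only [ofReal_re, add_re, mul_re, mul_im, conj_re, conj_im, ofReal_im]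
    ring
  · simp only [ofReal_im, add_im, mul_im, mul_re, conj_re, conj_im, ofReal_re]
    ring

variable (P : Params) (μ : Measure (ℝ × ℝ))

/-- The linear part in `z` does not see `y`, so a character of the phase space splits into a plane
wave in `z` and a phase in `y`. -/
theorem symm_chart (z : ℂ) (y : ℝ × ℝ) :
    phaseEquiv.symm (P.chart (z, y)) =
      slopeMap (P.s / √(2 * P.ℏ) * 2) (√(P.ℏ / 2) / P.s * -2) z +
        phaseEquiv.symm (P.chart (0, y)) := by
  rw [slopeMap_apply, ← map_add]
  congr 1
  simp only [chart, zero_re, zero_im]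
  refine Prod.ext (Prod.ext ?_ ?_) ?_
  · simp only [Prod.fst_add]
    ring
  · simp only [Prod.fst_add, Prod.snd_add]
    ring
  · simp

theorem hasCompactSupport_rho {F : Phase → ℂ} (hF : HasCompactSupport F) :
    HasCompactSupport (P.rho μ F) := by
  refine HasCompactSupport.intro (hF.isCompact.image P.continuous_zNC) fun z hz => ?_
  rw [rho_apply]
  refine integral_eq_zero_of_ae (.of_forall fun y => ?_)
  refine image_eq_zero_of_notMem_tsupport fun hy => hz ⟨_, hy, P.zNC_chart _⟩

variable [IsProbabilityMeasure μ]

/-- The image under `ϱ` of a smooth symbol is a superposition of plane waves, whose amplitude is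
bounded by the Fourier transform of the symbol. -/
theorem exists_rho_eq_waveIntegral {F : Phase → ℂ} {ψ : 𝓢(EuclideanSpace ℝ (Fin 4), ℂ)}
    (hψ : ∀ x, F x = ∫ ξ, (𝐞 ⟪ξ, phaseEquiv.symm x⟫_ℝ : ℂ) * ψ ξ) :
    ∃ c : EuclideanSpace ℝ (Fin 4) → ℂ, AEStronglyMeasurable c volume ∧ (∀ ξ, ‖c ξ‖ ≤ ‖ψ ξ‖) ∧
      P.rho μ F = waveIntegral volume c
        (frequency (P.s / √(2 * P.ℏ) * 2) (√(P.ℏ / 2) / P.s * -2)) := by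
  set a := frequency (P.s / √(2 * P.ℏ) * 2) (√(P.ℏ / 2) / P.s * -2) with ha
  obtain ⟨χ, hχ⟩ : ∃ χ : EuclideanSpace ℝ (Fin 4) → ℝ × ℝ → ℂ, ∀ ξ y,
      χ ξ y = (𝐞 ⟪ξ, phaseEquiv.symm (P.chart (0, y))⟫_ℝ : ℂ) := ⟨_, fun _ _ => rfl⟩
  have hχn : ∀ ξ y, ‖χ ξ y‖ = 1 := fun ξ y => by rw [hχ, Circle.norm_coe]
  have hcont : Continuous fun p : EuclideanSpace ℝ (Fin 4) × (ℝ × ℝ) => χ p.1 p.2 := by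
    have h1 : Continuous fun p : EuclideanSpace ℝ (Fin 4) × (ℝ × ℝ) =>
        ⟪p.1, phaseEquiv.symm (P.chart (0, p.2))⟫_ℝ :=
      continuous_fst.inner (phaseEquiv.symm.continuous.comp
        (P.continuous_chart.comp (continuous_const.prodMk continuous_snd)))
    simp only [hχ]
    exact continuous_subtype_val.comp (Real.continuous_fourierChar.comp h1)
  -- The amplitude is `ψ` times the `μ`-average of the phases. The average has modulus at most one,
  -- which disposes of `ϑ`, `κ` and `μ`.
  refine ⟨fun ξ => (∫ y, χ ξ y ∂μ) * ψ ξ, ?_, fun ξ => ?_, ?_⟩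
  · refine AEStronglyMeasurable.mul ?_ ψ.continuous.aestronglyMeasurable
    exact (hcont.aestronglyMeasurable (μ := volume.prod μ)).integral_prod_right'
  · rw [norm_mul]
    refine mul_le_of_le_one_left (norm_nonneg _) ?_
    refine (norm_integral_le_of_norm_le_const (C := 1) (.of_forall fun y => (hχn ξ y).le)).trans ?_
    simp
  · funext z
    have hint : Integrable (fun p : (ℝ × ℝ) × EuclideanSpace ℝ (Fin 4) =>
        (wave (a p.2) z * χ p.2 p.1) * ψ p.2) (μ.prod volume) := by
      have h1 : Integrable (fun p : (ℝ × ℝ) × EuclideanSpace ℝ (Fin 4) => ψ p.2)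
          (μ.prod volume) := (ψ.integrable (μ := volume)).comp_snd μ
      refine h1.bdd_mul (c := 1) ?_ (.of_forall fun p => ?_)
      · have h2 : Continuous fun p : (ℝ × ℝ) × EuclideanSpace ℝ (Fin 4) => wave (a p.2) z :=
          continuous_wave.comp ((a.continuous.comp continuous_snd).prodMk continuous_const)
        have h3 : Continuous fun p : (ℝ × ℝ) × EuclideanSpace ℝ (Fin 4) => χ p.2 p.1 :=
          hcont.comp continuous_swap
        exact (h2.mul h3).aestronglyMeasurable
      · rw [norm_mul, norm_wave, hχn, one_mul]
    have hswap := integral_integral_swap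
      (f := fun y ξ => (wave (a ξ) z * χ ξ y) * ψ ξ) hint
    rw [rho_apply, waveIntegral]
    refine Eq.trans ?_ (hswap.trans ?_)
    · congr 1 with y
      rw [hψ]
      congr 1 with ξ
      rw [symm_chart, inner_add_right, AddChar.map_add_eq_mul, Circle.coe_mul, ← wave_frequency, hχ]
    · congr 1 with ξ
      rw [← integral_mul_const, ← integral_mul_const]
      congr 1 with y
      ring

theorem contDiff_rho {F : Phase → ℂ} (hF : ContDiff ℝ (⊤ : ℕ∞) F) (hF' : HasCompactSupport F) :
    ContDiff ℝ (⊤ : ℕ∞) (P.rho μ F) := by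
  obtain ⟨ψ, hψ⟩ := exists_fourier_representation hF hF'
  obtain ⟨c, hc, hcψ, h⟩ := P.exists_rho_eq_waveIntegral μ hψ
  rw [h]
  exact contDiff_waveIntegral ((hasMoments_schwartz ψ).mono hc hcψ) _

/-! ### The star product expansion -/

theorem opNorm_le_of_unitary_intertwines {X : P.rkSpace μ →L[ℂ] P.rkSpace μ}
    {Y : fockSpace P.ℏ →L[ℂ] fockSpace P.ℏ}
    (h : ∀ u, X (P.unitary μ u) = P.unitary μ (Y u)) : ‖X‖ ≤ ‖Y‖ := by
  refine X.opNorm_le_bound Y.opNorm_nonneg fun w => ?_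
  obtain ⟨u, rfl⟩ := (P.unitary μ).surjective w
  rw [h, LinearIsometryEquiv.norm_map, LinearIsometryEquiv.norm_map]
  exact Y.le_opNorm u

theorem memLp_of_contDiff_of_hasCompactSupport {F : Phase → ℂ} (hF : ContDiff ℝ (⊤ : ℕ∞) F)
    (hF' : HasCompactSupport F) (ν : Measure Phase) : MemLp F ⊤ ν := by
  obtain ⟨C, hC⟩ := hF'.exists_bound_of_continuous hF.continuous
  exact memLp_top_of_bound hF.continuous.aestronglyMeasurable C (.of_forall hC)

/-- The Fock space estimate is transported by the unitary map, and the amplitudes of `ϱF`, `ϱG` are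
replaced by their bounds `ψ`, `χ`, so that the parameters remain only in `a` and the power of `ℏ`.
-/
theorem norm_toeplitz_comp_sub_sum_le {F G : Phase → ℂ} (hF : ContDiff ℝ (⊤ : ℕ∞) F)
    (hF' : HasCompactSupport F) (hG : ContDiff ℝ (⊤ : ℕ∞) G) (hG' : HasCompactSupport G)
    {ψ χ : 𝓢(EuclideanSpace ℝ (Fin 4), ℂ)}
    (hψ : ∀ x, F x = ∫ ξ, (𝐞 ⟪ξ, phaseEquiv.symm x⟫_ℝ : ℂ) * ψ ξ)
    (hχ : ∀ x, G x = ∫ ξ, (𝐞 ⟪ξ, phaseEquiv.symm x⟫_ℝ : ℂ) * χ ξ)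
    {t : (ℂ → ℂ) → Phase → ℂ} (ht : P.IsRightInverse μ t) (N : ℕ)
    {a : EuclideanSpace ℝ (Fin 4) →L[ℝ] ℂ}
    (ha : a = frequency (P.s / √(2 * P.ℏ) * 2) (√(P.ℏ / 2) / P.s * -2)) :
    ‖toeplitz (P.rkSpace μ) F ∘L toeplitz (P.rkSpace μ) G -
        ∑ j ∈ Finset.range (N + 1), (P.ℏ : ℂ) ^ j •
          toeplitz (P.rkSpace μ) (t (starCoeff j (P.rho μ F) (P.rho μ G)))‖ ≤
      (∫ ξ, ‖a ξ‖ ^ (N + 1) * ‖ψ ξ‖) * (∫ ξ, ‖a ξ‖ ^ (N + 1) * ‖χ ξ‖) * P.ℏ ^ (N + 1) := by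
  obtain ⟨c, hc, hcψ, hρF⟩ := P.exists_rho_eq_waveIntegral μ hψ
  obtain ⟨d, hd, hdχ, hρG⟩ := P.exists_rho_eq_waveIntegral μ hχ
  rw [← ha] at hρF hρG
  have hcm := (hasMoments_schwartz ψ).mono hc hcψ
  have hdm := (hasMoments_schwartz χ).mono hd hdχ
  have hmain := norm_toeplitz_waveIntegral_comp_sub_sum_le P.ℏ_pos hc a.continuous.measurable
    (hcm.integrable_pow_mul a) hd a.continuous.measurable (hdm.integrable_pow_mul a) N
  have hstar : ∀ j, MemLp (starCoeff j (P.rho μ F) (P.rho μ G)) ⊤ volume := fun j => by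
    rw [hρF, hρG]
    exact memLp_starCoeff_waveIntegral hcm hdm a a j _
  have hinter : ∀ u, (toeplitz (P.rkSpace μ) F ∘L toeplitz (P.rkSpace μ) G -
        ∑ j ∈ Finset.range (N + 1), (P.ℏ : ℂ) ^ j •
          toeplitz (P.rkSpace μ) (t (starCoeff j (P.rho μ F) (P.rho μ G)))) (P.unitary μ u) =
      P.unitary μ ((toeplitz (fockSpace P.ℏ) (P.rho μ F) ∘L
        toeplitz (fockSpace P.ℏ) (P.rho μ G) -
        ∑ j ∈ Finset.range (N + 1), (P.ℏ : ℂ) ^ j •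
          toeplitz (fockSpace P.ℏ) (starCoeff j (P.rho μ F) (P.rho μ G))) u) := by
    intro u
    simp only [sub_apply, ContinuousLinearMap.comp_apply, sum_apply, smul_apply, map_sub, map_sum,
      map_smul]
    rw [toeplitz_unitary P μ (memLp_of_contDiff_of_hasCompactSupport hG hG' _),
      toeplitz_unitary P μ (memLp_of_contDiff_of_hasCompactSupport hF hF' _)]
    congr 1
    refine Finset.sum_congr rfl fun j _ => ?_
    -- The right inverse enters only through `ϱ (t f) = f` almost everywhere, and Toeplitz operators
    -- ignore null sets; hence any right inverse gives the same operator.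
    rw [toeplitz_unitary P μ (ht _ (hstar j)).1, toeplitz_congr_ae (fockSpace P.ℏ)
      ((fockMeasure_absolutelyContinuous P.ℏ).ae_eq (ht _ (hstar j)).2)]
  refine (P.opNorm_le_of_unitary_intertwines μ hinter).trans ?_
  rw [hρF, hρG]
  simp only [starCoeff_waveIntegral hcm hdm]
  have hℏ := P.ℏ_pos
  refine hmain.trans ?_
  have h1 : ∫ ξ, ‖a ξ‖ ^ (N + 1) * ‖c ξ‖ ≤ ∫ ξ, ‖a ξ‖ ^ (N + 1) * ‖ψ ξ‖ :=
    integral_mono (hcm.integrable_pow_mul a _) ((hasMoments_schwartz ψ).integrable_pow_mul a _)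
      fun ξ => mul_le_mul_of_nonneg_left (hcψ ξ) (by positivity)
  have h2 : ∫ ξ, ‖a ξ‖ ^ (N + 1) * ‖d ξ‖ ≤ ∫ ξ, ‖a ξ‖ ^ (N + 1) * ‖χ ξ‖ :=
    integral_mono (hdm.integrable_pow_mul a _) ((hasMoments_schwartz χ).integrable_pow_mul a _)
      fun ξ => mul_le_mul_of_nonneg_left (hdχ ξ) (by positivity)
  gcongr

end Params

end FourierRepresentation

end DegenerateNC

/-! ### Assembly of the four assertions. -/

theorem mainTheorem8 :
    (∀ (P : DegenerateNC.Params) (μ : MeasureTheory.Measure (ℝ × ℝ))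
        [MeasureTheory.IsProbabilityMeasure μ],
      (∃ _ : RKHS ℂ (P.rkSpace μ) DegenerateNC.Phase ℂ,
        DegenerateNC.IsRKHSWithKernel (P.rkSpace μ) P.kernel ∧
        ∃ V : DegenerateNC.fockSpace P.ℏ ≃ₗᵢ[ℂ] P.rkSpace μ,
          (∀ (f : DegenerateNC.fockSpace P.ℏ) (g : ℂ → ℂ), Differentiable ℂ g →
            (f : MeasureTheory.Lp ℂ 2 (DegenerateNC.fockMeasure P.ℏ))
              =ᵐ[DegenerateNC.fockMeasure P.ℏ] g →
            ∀ x, RKHS.coeCLM ℂ (V f) x = P.transform g x) ∧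
          ∀ F : DegenerateNC.Phase → ℂ, MeasureTheory.MemLp F ⊤ (P.nu μ) →
            MeasureTheory.MemLp (P.rho μ F) ⊤ (MeasureTheory.volume : MeasureTheory.Measure ℂ) ∧
            (V.toContinuousLinearEquiv :
                DegenerateNC.fockSpace P.ℏ →L[ℂ] P.rkSpace μ).adjoint ∘L
              DegenerateNC.toeplitz (P.rkSpace μ) F ∘L
              (V.toContinuousLinearEquiv : DegenerateNC.fockSpace P.ℏ →L[ℂ] P.rkSpace μ) =
              DegenerateNC.toeplitz (DegenerateNC.fockSpace P.ℏ) (P.rho μ F)) ∧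
      P.IsRightInverse μ P.rhoStar ∧
      ∀ F : DegenerateNC.Phase → ℂ, ContDiff ℝ (⊤ : ℕ∞) F → HasCompactSupport F →
        ContDiff ℝ (⊤ : ℕ∞) (P.rho μ F) ∧ HasCompactSupport (P.rho μ F)) ∧
    (∀ (S : ℝ), 0 < S → ∀ F G : DegenerateNC.Phase → ℂ,
      ContDiff ℝ (⊤ : ℕ∞) F → HasCompactSupport F →
      ContDiff ℝ (⊤ : ℕ∞) G → HasCompactSupport G →
      ∀ N : ℕ, ∃ C : ℝ, ∀ P : DegenerateNC.Params, P.s = S * √P.ℏ →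
        ∀ (μ : MeasureTheory.Measure (ℝ × ℝ)) [MeasureTheory.IsProbabilityMeasure μ]
          (t : (ℂ → ℂ) → DegenerateNC.Phase → ℂ), P.IsRightInverse μ t →
          ‖DegenerateNC.toeplitz (P.rkSpace μ) F ∘L DegenerateNC.toeplitz (P.rkSpace μ) G -
              ∑ j ∈ Finset.range (N + 1), (P.ℏ : ℂ) ^ j •
                DegenerateNC.toeplitz (P.rkSpace μ)
                  (t (DegenerateNC.starCoeff j (P.rho μ F) (P.rho μ G)))‖
            ≤ C * P.ℏ ^ (N + 1)) := by
  refine ⟨fun P μ _ => ⟨⟨P.rkhs μ, P.isRKHSWithKernel μ, P.unitary μ, ?_, fun F hF =>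
    ⟨P.memLp_rho μ hF, P.adjoint_unitary_comp_toeplitz_comp μ hF⟩⟩, P.isRightInverse_rhoStar μ,
    fun F hF hF' => ⟨P.contDiff_rho μ hF hF', P.hasCompactSupport_rho μ hF'⟩⟩, ?_⟩
  · intro f g hg hfg x
    rw [← DegenerateNC.entireRep_eq P.ℏ_pos hg hfg]
    exact congrFun (P.rkhs_coeCLM_unitary μ f) x
  · intro S hS F G hF hF' hG hG' N
    obtain ⟨ψ, hψ⟩ := DegenerateNC.exists_fourier_representation hF hF'
    obtain ⟨χ, hχ⟩ := DegenerateNC.exists_fourier_representation hG hG'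
    -- These are the slopes of the chart for `s = S√ℏ`: `s/√(2ℏ) = S/√2` and `√(ℏ/2)/s = 1/(√2 S)`.
    -- As `ℏ` cancels, the constant can be fixed before `P`.
    set a := DegenerateNC.Params.frequency (S / √2 * 2) (1 / (√2 * S) * -2) with ha
    refine ⟨(∫ ξ, ‖a ξ‖ ^ (N + 1) * ‖ψ ξ‖) * (∫ ξ, ‖a ξ‖ ^ (N + 1) * ‖χ ξ‖), ?_⟩
    intro P hs μ _ t ht
    refine P.norm_toeplitz_comp_sub_sum_le μ hF hF' hG hG' hψ hχ ht N ?_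
    have hℏ : √P.ℏ ≠ 0 := (Real.sqrt_pos.2 P.ℏ_pos).ne'
    rw [ha, hs, Real.sqrt_mul (by norm_num : (0 : ℝ) ≤ 2), Real.sqrt_div P.ℏ_pos.le]
    congr 2 <;> field_simp
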